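/- **Inner Kernel Theorem.** All Hilbert spaces are complex and scalar products are linear in the first variable; $I,J$ are countable. *Localised frames.* A spectral matrix algebra $\mathcal A$ over $I\times I$ is an involutive Banach algebra of matrices that define bounded operators on $\ell^2(I)$ (product: matrix product; involution: conjugate transpose, isometric) which is inverse-closed in $B(\ell^2(I))$ (if $A\in\mathcal A$, $c\in\mathbb C$ and $c\,\mathrm{Id}+A$ is invertible in $B(\ell^2(I))$, then its inverse lies in $\mathbb C\,\mathrm{Id}+\mathcal A$; when $\mathrm{Id}\in\mathcal A$ this says that $\mathcal A$ contains the inverses of its elements that are invertible in $B(\ell^2(I))$) and solid (if $A\in\mathcal A$ and $|b_{i,j}|\le|a_{i,j}|$ for all $i,j$, then $B\in\mathcal A$ and $\|B\|_{\mathcal A}\le\|A\|_{\mathcal A}$). A frame $\Psi=\{\psi_i\}_{i\in I}$ for a Hilbert space $\mathcal H$ is $\mathcal A$-localised if its Gram matrix $(\langle\psi_{i'},\psi_i\rangle)_{i,i'}$ lies in $\mathcal A$; $\widetilde\Psi=\{\widetilde\psi_i\}$ is its canonical dual frame. A weight $w=\{w_i\}$, $w_i>0$, is $\mathcal A$-admissible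 if every $A\in\mathcal A$ defines a bounded operator on $\ell^p_w(I)=\{c: cw\in\ell^p(I)\}$ for every $1\le p\le\infty$. *Co-orbit spaces.* $\mathcal H^1_w(\Psi)$ is the completion of $\operatorname{span}\{\psi_i\}$ with respect to the norm $\|C_{\widetilde\Psi}f\|_{\ell^1_w}$, where $C_{\widetilde\Psi}f=(\langle f,\widetilde\psi_i\rangle)_i$. $\mathcal H^\infty_{w}(\Psi)$ is the space of classes $F=[(F_n)]$ of sequences in $\mathcal H$ such that $(C_{\widetilde\Psi}F)_i:=\lim_n\langle F_n,\widetilde\psi_i\rangle$ exists for all $i$ and $\sup_n\|C_{\widetilde\Psi}F_n\|_{\ell^\infty_w}<\infty$, two sequences being equivalent if $\lim_n\langle F_n-F_n',\widetilde\psi_i\rangle=0$ for all $i$, with norm $\|F\|=\|C_{\widetilde\Psi}F\|_{\ell^\infty_w}$; put $(C_\Psi F)_i:=\lim_n\langle F_n,\psi_i\rangle$. For $f\in\mathcal H^1_w(\Psi)$ and $g\in\mathcal H^\infty_{1/w}(\Psi)$ let $\langle f,g\rangle=\sum_i(C_{\widetilde\Psi}f)_i\overline{(C_\Psi g)_i}$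 and $\langle g,f\rangle=\overline{\langle f,g\rangle}$. *Tensor products.* $\mathcal H_1\otimes\mathcal H_2$ is the Hilbert space of Hilbert–Schmidt operators $\mathcal H_1\to\mathcal H_2$, with $f_1\otimes f_2:=\langle\,\cdot\,,f_1\rangle f_2$. Replacing in the above $\mathcal H,\Psi,\widetilde\Psi,w$ by $\mathcal H_1\otimes\mathcal H_2$, $\Psi_1\otimes\Psi_2=\{\psi_{1,i}\otimes\psi_{2,j}\}$, $\widetilde\Psi_1\otimes\widetilde\Psi_2$ and $w_1\otimes w_2=\{w_{1,i}w_{2,j}\}$ (respectively $1/(w_1\otimes w_2)$) one obtains the spaces $\mathcal H^{1,1}_{w_1\otimes w_2}(\Psi_1\otimes\Psi_2)$ and $\mathcal H^{\infty,\infty}_{1/(w_1\otimes w_2)}(\Psi_1\otimes\Psi_2)$ and their duality. For $f_k=[(f_{k,n})_n]\in\mathcal H^\infty_{1/w_k}(\Psi_k)$, $k=1,2$, let $f_1\otimes f_2:=[(f_{1,n}\otimes f_{2,n})_n]\in\mathcal H^{\infty,\infty}_{1/(w_1\otimes w_2)}(\Psi_1\otimes\Psi_2)$. **Theorem.** For $n=1,2$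 let $\Psi_n$ be an $\mathcal A_n$-localised frame for a Hilbert space $\mathcal H_n$ (indexed by $I$ and $J$ respectively), where $\mathcal A_n$ is a spectral matrix algebra, and let $w_n$ be an $\mathcal A_n$-admissible weight. Let $\mathcal B$ be the space of all bounded operators $O:\mathcal H^\infty_{1/w_1}(\Psi_1)\to\mathcal H^1_{w_2}(\Psi_2)$ of the form $$O=\sum_{r\in\mathbb N}\langle\,\cdot\,,f_r\rangle\,g_r,\qquad f_r\in\mathcal H^1_{w_1}(\Psi_1),\ g_r\in\mathcal H^1_{w_2}(\Psi_2),\qquad \sum_{r}\|f_r\|\,\|g_r\|<\infty ,$$ normed by $\|O\|_{\mathcal B}=\inf\sum_r\|f_r\|\,\|g_r\|$, the infimum being taken over all such representations. Then there is a linear bijection $\Phi:\mathcal H^{1,1}_{w_1\otimes w_2}(\Psi_1\otimes\Psi_2)\to\mathcal B$ with $\|\Phi(K)\|_{\mathcal B}\asymp\|K\|$, such that $O=\Phi(K)$ satisfies $$\langle K,f_1\otimes f_2\rangle=\langle Of_1,f_2\rangle\qquad\text{for all } f_1\in\mathcal H^\infty_{1/w_1}(\Psi_1),\ f_2\in\mathcal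 H^\infty_{1/w_2}(\Psi_2).\tag{$*$}$$ Moreover, for each $K\in\mathcal H^{1,1}_{w_1\otimes w_2}(\Psi_1\otimes\Psi_2)$ there is exactly one $O\in\mathcal B$ satisfying $(*)$, and for each $O\in\mathcal B$ there is exactly one $K\in\mathcal H^{1,1}_{w_1\otimes w_2}(\Psi_1\otimes\Psi_2)$ satisfying $(*)$. -/

import Mathlib

open scoped ENNReal ComplexConjugate Topology
open Filter

noncomputable section

namespace Coorbit

/-! ### Spectral matrix algebras and admissible weights -/

/-- The Hilbert space `ℓ²(I)`. -/
abbrev Ell2 (I : Type*) : Type _ := lp (fun _ : I => ℂ) 2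

open Classical in
/-- The matrix entry `T_{i,j}` of a bounded operator on `ℓ²(I)`. -/
def entry {I : Type*} (T : Ell2 I →L[ℂ] Ell2 I) (i j : I) : ℂ :=
  (T (lp.single 2 j (1 : ℂ)) : Ell2 I) i

/-- A (solid) spectral matrix algebra over `I × I`: a Banach `*`-algebra of matrices which define
bounded operators on `ℓ²(I)` (a matrix is identified with the operator it defines, so that the
product is the matrix product and the involution is the conjugate transpose), which is inverse-closed
in `B(ℓ²(I))` and solid.

Inverse-closedness is stated for `ℂ 1 + 𝒜`, as is usual for an algebra that need not contain the
identity; for an algebra that contains the identity it says that `A ∈ 𝒜` invertible in `B(ℓ²(I))`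
implies `A⁻¹ ∈ 𝒜`. -/
structure SpectralMatrixAlgebra (I : Type*) where
  carrier : NonUnitalStarSubalgebra ℂ (Ell2 I →L[ℂ] Ell2 I)
  /-- the norm of the algebra -/
  norm : Seminorm ℂ carrier
  eq_zero_of_norm : ∀ A : carrier, norm A = 0 → A = 0
  norm_mul_le : ∀ A B : carrier, norm (A * B) ≤ norm A * norm B
  norm_star : ∀ A : carrier, norm (star A) = norm A
  complete : ∀ u : ℕ → carrier,
    (∀ ε : ℝ, 0 < ε → ∃ N, ∀ m ≥ N, ∀ n ≥ N, norm (u m - u n) < ε) →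
    ∃ A : carrier, Tendsto (fun n => norm (u n - A)) atTop (𝓝 0)
  inverse_closed : ∀ (c : ℂ) (A : Ell2 I →L[ℂ] Ell2 I), A ∈ carrier →
    ∀ T : Ell2 I →L[ℂ] Ell2 I, (c • 1 + A) * T = 1 → T * (c • 1 + A) = 1 →
      ∃ (d : ℂ) (B : Ell2 I →L[ℂ] Ell2 I), B ∈ carrier ∧ T = d • 1 + B
  solid : ∀ (A : carrier) (b : I → I → ℂ), (∀ i j, ‖b i j‖ ≤ ‖entry (A : Ell2 I →L[ℂ] Ell2 I) i j‖) →
    ∃ B : carrier, (∀ i j, entry (B : Ell2 I →L[ℂ] Ell2 I) i j = b i j) ∧ norm B ≤ norm A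

/-- For an algebra containing the identity, the inverse of an invertible member is a member. -/
theorem SpectralMatrixAlgebra.inverse_mem {I : Type*} (𝒜 : SpectralMatrixAlgebra I)
    {A T : Ell2 I →L[ℂ] Ell2 I} (hA : A ∈ 𝒜.carrier)
    (h1 : A * T = 1) (h2 : T * A = 1) : T ∈ 𝒜.carrier := by
  obtain ⟨d, B, hB, rfl⟩ := 𝒜.inverse_closed 0 A hA T (by simpa using h1) (by simpa using h2)
  have hone : (1 : Ell2 I →L[ℂ] Ell2 I) ∈ 𝒜.carrier := by
    rw [← h1, mul_add, mul_smul_comm, mul_one]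
    exact add_mem (SMulMemClass.smul_mem d hA) (mul_mem hA hB)
  exact add_mem (SMulMemClass.smul_mem d hone) hB

/-- A weight on `I`: a family of positive real numbers. -/
abbrev Weight (I : Type*) : Type _ := I → {x : ℝ // 0 < x}

/-- The weight `w₁ ⊗ w₂` on `I × J`. -/
def tensorWeight {I J : Type*} (w₁ : Weight I) (w₂ : Weight J) : Weight (I × J) :=
  fun p => w₁ p.1 * w₂ p.2

/-- `w` is `𝒜`-admissible: for all `1 ≤ p ≤ ∞`, every `A ∈ 𝒜` defines a bounded operator on
`ℓ^p_w(I)`. Here `c ∈ ℓ^p_w(I)` is written as `c = x / w` with `x ∈ ℓ^p(I)`,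
`‖c‖_{ℓ^p_w} = ‖x‖_{ℓ^p}`, and `T` is the operator `A` in terms of `x`. -/
def Admissible {I : Type*} (𝒜 : SpectralMatrixAlgebra I) (w : Weight I) : Prop :=
  ∀ A ∈ 𝒜.carrier, ∀ (p : ℝ≥0∞) [Fact (1 ≤ p)],
    ∃ T : lp (fun _ : I => ℂ) p →L[ℂ] lp (fun _ : I => ℂ) p,
      ∀ (x : lp (fun _ : I => ℂ) p) (i : I),
        HasSum (fun j => entry A i j * (x j / ((w j : ℝ) : ℂ))) ((T x) i / ((w i : ℝ) : ℂ))

/-! ### Frames -/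

section Frames

variable {ι H : Type*} [NormedAddCommGroup H] [InnerProductSpace ℂ H]

/-- The family `ψ` is a frame for `H`. -/
def IsFrame (ψ : ι → H) : Prop :=
  ∃ A B : ℝ, 0 < A ∧ 0 < B ∧ ∀ f : H,
    Summable (fun i => ‖inner ℂ (ψ i) f‖ ^ 2) ∧
    A * ‖f‖ ^ 2 ≤ ∑' i, ‖inner ℂ (ψ i) f‖ ^ 2 ∧
    ∑' i, ‖inner ℂ (ψ i) f‖ ^ 2 ≤ B * ‖f‖ ^ 2

/-- The frame operator `S f = ∑ᵢ ⟨f, ψᵢ⟩ ψᵢ` (with Mathlib's inner product, which is linear in the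
second variable, `⟨f, ψᵢ⟩` is `inner ℂ (ψ i) f`). -/
def frameOp (ψ : ι → H) (f : H) : H := ∑' i, inner ℂ (ψ i) f • ψ i

/-- The canonical dual frame `S⁻¹ ψᵢ`; the frame operator of a frame of a Hilbert space is
bijective. -/
def canonicalDual (ψ : ι → H) (i : ι) : H := Function.invFun (frameOp ψ) (ψ i)

/-- The frame `ψ` is `𝒜`-localised: its Gram matrix `(⟨ψ_{i'}, ψ_i⟩)_{i,i'}` belongs to `𝒜`. -/
def IsLocalisedFrame (𝒜 : SpectralMatrixAlgebra ι) (ψ : ι → H) : Prop :=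
  IsFrame ψ ∧ ∃ A ∈ 𝒜.carrier, ∀ i i', entry A i i' = inner ℂ (ψ i) (ψ i')

end Frames

/-! ### Co-orbit spaces

In this section `ψ` is a frame and `ψd` its (canonical) dual frame. -/

section Spaces

variable {ι H : Type*} [NormedAddCommGroup H] [InnerProductSpace ℂ H]

/-- The space `ℋ₀₀(ψ)` of finite linear combinations of the `ψᵢ`, restricted to the vectors whose
norm `‖C_{ψd} f‖_{ℓ¹_w}` is finite (all of them when `ψ` is a localised frame with canonical dual
`ψd` and `w` is admissible). -/
def preOne (ψ ψd : ι → H) (w : Weight ι) : Submodule ℂ H where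
  carrier := {f | f ∈ Submodule.span ℂ (Set.range ψ) ∧
    Memℓp (fun i => ((w i : ℝ) : ℂ) * inner ℂ (ψd i) f) 1}
  zero_mem' := by
    refine ⟨zero_mem _, ?_⟩
    simp only [inner_zero_right, mul_zero]
    exact zero_memℓp
  add_mem' := by
    rintro f g ⟨hf, hf'⟩ ⟨hg, hg'⟩
    refine ⟨add_mem hf hg, ?_⟩
    convert hf'.add hg' using 1
    ext i
    simp [mul_add]
  smul_mem' := by
    rintro c f ⟨hf, hf'⟩
    refine ⟨Submodule.smul_mem _ c hf, ?_⟩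
    convert hf'.const_smul c using 1
    ext i
    simp
    ring

/-- `ℋ₀₀(ψ)` with the norm `f ↦ ‖C_{ψd} f‖_{ℓ¹_w}`. -/
def PreCoorbitOne (ψ ψd : ι → H) (w : Weight ι) : Type _ := ↥(preOne ψ ψd w)

instance (ψ ψd : ι → H) (w : Weight ι) : AddCommGroup (PreCoorbitOne ψ ψd w) :=
  inferInstanceAs (AddCommGroup ↥(preOne ψ ψd w))

instance (ψ ψd : ι → H) (w : Weight ι) : Module ℂ (PreCoorbitOne ψ ψd w) :=
  inferInstanceAs (Module ℂ ↥(preOne ψ ψd w))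

/-- The underlying vector of `H`. -/
def PreCoorbitOne.val {ψ ψd : ι → H} {w : Weight ι} (f : PreCoorbitOne ψ ψd w) : H :=
  Subtype.val f

/-- `f ↦ w · C_{ψd} f ∈ ℓ¹`. -/
def preAnalysisOne (ψ ψd : ι → H) (w : Weight ι) :
    PreCoorbitOne ψ ψd w →ₗ[ℂ] lp (fun _ : ι => ℂ) 1 where
  toFun f := ⟨fun i => ((w i : ℝ) : ℂ) * inner ℂ (ψd i) f.val, f.2.2⟩
  map_add' f g := by
    ext i
    exact (by rw [inner_add_right, mul_add] :
      ((w i : ℝ) : ℂ) * inner ℂ (ψd i) (f.val + g.val) =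
        ((w i : ℝ) : ℂ) * inner ℂ (ψd i) f.val + ((w i : ℝ) : ℂ) * inner ℂ (ψd i) g.val)
  map_smul' c f := by
    ext i
    exact (by rw [inner_smul_right, smul_eq_mul]; ring :
      ((w i : ℝ) : ℂ) * inner ℂ (ψd i) (c • f.val) =
        c • (((w i : ℝ) : ℂ) * inner ℂ (ψd i) f.val))

instance (ψ ψd : ι → H) (w : Weight ι) : SeminormedAddCommGroup (PreCoorbitOne ψ ψd w) :=
  SeminormedAddCommGroup.induced _ _ (preAnalysisOne ψ ψd w)

instance (ψ ψd : ι → H) (w : Weight ι) : NormedSpace ℂ (PreCoorbitOne ψ ψd w) :=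
  NormedSpace.induced ℂ _ _ (preAnalysisOne ψ ψd w)

/-- The co-orbit space `ℋ¹_w(ψ)`: the norm completion of `ℋ₀₀(ψ)`. -/
abbrev CoorbitOne (ψ ψd : ι → H) (w : Weight ι) : Type _ :=
  UniformSpace.Completion (PreCoorbitOne ψ ψd w)

/-- The coefficients `(C_{ψd} F)_i` of `F ∈ ℋ¹_w(ψ)`, extended by continuity from `ℋ₀₀(ψ)`. -/
def CoorbitOne.coef {ψ ψd : ι → H} {w : Weight ι} (F : CoorbitOne ψ ψd w) (i : ι) : ℂ :=
  UniformSpace.Completion.extension (fun f : PreCoorbitOne ψ ψd w => inner ℂ (ψd i) f.val) F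

/-- The sequences `(F_n)` in `H` for which `lim_n ⟨F_n, ψd_i⟩` exists for all `i` and
`sup_n ‖C_{ψd} F_n‖_{ℓ^∞_w} < ∞`. -/
def infSeq (ψd : ι → H) (w : Weight ι) : Submodule ℂ (ℕ → H) where
  carrier := {F | (∀ i, ∃ k : ℂ, Tendsto (fun n => inner ℂ (ψd i) (F n)) atTop (𝓝 k)) ∧
    ∃ M : ℝ, ∀ n i, (w i : ℝ) * ‖inner ℂ (ψd i) (F n)‖ ≤ M}
  zero_mem' := ⟨fun i => ⟨0, by simp⟩, 0, by simp⟩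
  add_mem' := by
    rintro F G ⟨hF, M, hM⟩ ⟨hG, N, hN⟩
    refine ⟨fun i => ?_, M + N, fun n i => ?_⟩
    · obtain ⟨k, hk⟩ := hF i
      obtain ⟨l, hl⟩ := hG i
      exact ⟨k + l, by simpa [inner_add_right] using hk.add hl⟩
    · have h1 := hM n i
      have h2 := hN n i
      have h3 := mul_le_mul_of_nonneg_left
        (norm_add_le (inner ℂ (ψd i) (F n)) (inner ℂ (ψd i) (G n))) (w i).2.le
      simp only [Pi.add_apply, inner_add_right]
      linarith
  smul_mem' := by
    rintro c F ⟨hF, M, hM⟩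
    refine ⟨fun i => ?_, ‖c‖ * M, fun n i => ?_⟩
    · obtain ⟨k, hk⟩ := hF i
      exact ⟨c * k, by simpa [inner_smul_right] using hk.const_mul c⟩
    · have h1 := mul_le_mul_of_nonneg_left (hM n i) (norm_nonneg c)
      simp only [Pi.smul_apply, inner_smul_right, norm_mul]
      linarith

theorem infSeq_tendsto {ψd : ι → H} {w : Weight ι} (F : infSeq ψd w) (i : ι) :
    Tendsto (fun n => inner ℂ (ψd i) (F.1 n)) atTop
      (𝓝 (limUnder atTop fun n => inner ℂ (ψd i) (F.1 n))) :=
  tendsto_nhds_limUnder (F.2.1 i)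

/-- `(F_n) ↦ (lim_n ⟨F_n, ψd_i⟩)_i`. -/
def infLim (ψd : ι → H) (w : Weight ι) : infSeq ψd w →ₗ[ℂ] (ι → ℂ) where
  toFun F i := limUnder atTop fun n => inner ℂ (ψd i) (F.1 n)
  map_add' F G := by
    ext i
    refine ((infSeq_tendsto F i).add (infSeq_tendsto G i)).congr (fun n => ?_) |>.limUnder_eq
    simp
  map_smul' c F := by
    ext i
    refine ((infSeq_tendsto F i).const_mul c).congr (fun n => ?_) |>.limUnder_eq
    simp

/-- The co-orbit space `ℋ^∞_w(ψ)`: the space of equivalence classes of sequences `(F_n)` as in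
`infSeq`, where `(F_n)` and `(F'_n)` are equivalent if `lim_n ⟨F_n - F'_n, ψd_i⟩ = 0` for all `i`. -/
def CoorbitInf (ψd : ι → H) (w : Weight ι) : Type _ :=
  ↥(infSeq ψd w) ⧸ LinearMap.ker (infLim ψd w)

instance (ψd : ι → H) (w : Weight ι) : AddCommGroup (CoorbitInf ψd w) :=
  inferInstanceAs (AddCommGroup (↥(infSeq ψd w) ⧸ LinearMap.ker (infLim ψd w)))

instance (ψd : ι → H) (w : Weight ι) : Module ℂ (CoorbitInf ψd w) :=
  inferInstanceAs (Module ℂ (↥(infSeq ψd w) ⧸ LinearMap.ker (infLim ψd w)))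

/-- The class of a sequence. -/
def CoorbitInf.mk {ψd : ι → H} {w : Weight ι} (F : infSeq ψd w) : CoorbitInf ψd w :=
  Submodule.Quotient.mk F

/-- A sequence representing a class. -/
def CoorbitInf.rep {ψd : ι → H} {w : Weight ι} (F : CoorbitInf ψd w) : infSeq ψd w :=
  Quotient.out F

/-- The coefficients `(C_{ψd} F)_i = lim_n ⟨F_n, ψd_i⟩` of `F = [(F_n)] ∈ ℋ^∞_w(ψ)`. -/
def CoorbitInf.coef (ψd : ι → H) (w : Weight ι) : CoorbitInf ψd w →ₗ[ℂ] (ι → ℂ) :=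
  (LinearMap.ker (infLim ψd w)).liftQ (infLim ψd w) le_rfl

theorem CoorbitInf.coef_injective (ψd : ι → H) (w : Weight ι) :
    Function.Injective (CoorbitInf.coef ψd w) := by
  rw [← LinearMap.ker_eq_bot]
  exact Submodule.ker_liftQ_eq_bot _ _ _ le_rfl

theorem CoorbitInf.memℓp_coef {ψd : ι → H} {w : Weight ι} (F : CoorbitInf ψd w) :
    Memℓp (fun i => ((w i : ℝ) : ℂ) * CoorbitInf.coef ψd w F i) ∞ := by
  obtain ⟨F, rfl⟩ := Submodule.Quotient.mk_surjective _ F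
  obtain ⟨M, hM⟩ := F.2.2
  refine memℓp_infty ⟨M, ?_⟩
  rintro _ ⟨i, rfl⟩
  refine le_of_tendsto ((infSeq_tendsto F i).const_mul ((w i : ℝ) : ℂ)).norm
    (Eventually.of_forall fun n => ?_)
  simpa [abs_of_pos (w i).2] using hM n i

/-- `F ↦ w · C_{ψd} F ∈ ℓ^∞`. -/
def CoorbitInf.analysis (ψd : ι → H) (w : Weight ι) :
    CoorbitInf ψd w →ₗ[ℂ] lp (fun _ : ι => ℂ) ∞ where
  toFun F := ⟨fun i => ((w i : ℝ) : ℂ) * CoorbitInf.coef ψd w F i, F.memℓp_coef⟩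
  map_add' F G := by
    ext i
    change ((w i : ℝ) : ℂ) * CoorbitInf.coef ψd w (F + G) i =
      ((w i : ℝ) : ℂ) * CoorbitInf.coef ψd w F i + ((w i : ℝ) : ℂ) * CoorbitInf.coef ψd w G i
    rw [map_add, Pi.add_apply, mul_add]
  map_smul' c F := by
    ext i
    change ((w i : ℝ) : ℂ) * CoorbitInf.coef ψd w (c • F) i =
      c * (((w i : ℝ) : ℂ) * CoorbitInf.coef ψd w F i)
    rw [map_smul, Pi.smul_apply, smul_eq_mul]
    ring

theorem CoorbitInf.analysis_injective (ψd : ι → H) (w : Weight ι) :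
    Function.Injective (CoorbitInf.analysis ψd w) := by
  intro F G h
  refine CoorbitInf.coef_injective ψd w (funext fun i => ?_)
  have h' := congrArg (fun x : lp (fun _ : ι => ℂ) ∞ => x i) h
  exact mul_left_cancel₀ (by exact_mod_cast (w i).2.ne') h'

/-- The norm `‖F‖ = ‖C_{ψd} F‖_{ℓ^∞_w}`. -/
instance (ψd : ι → H) (w : Weight ι) : NormedAddCommGroup (CoorbitInf ψd w) :=
  NormedAddCommGroup.induced _ _ (CoorbitInf.analysis ψd w) (CoorbitInf.analysis_injective ψd w)

instance (ψd : ι → H) (w : Weight ι) : NormedSpace ℂ (CoorbitInf ψd w) :=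
  NormedSpace.induced ℂ _ _ (CoorbitInf.analysis ψd w)

/-- The coefficients `(C_ψ F)_i = lim_n ⟨F_n, ψ_i⟩` of `F = [(F_n)] ∈ ℋ^∞_w(ψ)` with respect to
the frame `ψ` itself. -/
def CoorbitInf.frameCoef {ψd : ι → H} {w : Weight ι} (ψ : ι → H) (F : CoorbitInf ψd w)
    (i : ι) : ℂ :=
  limUnder atTop fun n => inner ℂ (ψ i) (F.rep.1 n)

/-- The duality `⟨F, G⟩ = ∑ᵢ (C_{ψd} F)_i * conj (C_ψ G)_i` between `F ∈ ℋ¹_w(ψ)` and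
`G ∈ ℋ^∞_{1/w}(ψ)`. -/
def pairing {ψ ψd : ι → H} {w : Weight ι} (F : CoorbitOne ψ ψd w) (G : CoorbitInf ψd w⁻¹) : ℂ :=
  ∑' i, F.coef i * conj (G.frameCoef ψ i)

/-- The duality `⟨G, F⟩ = conj ⟨F, G⟩` between `G ∈ ℋ^∞_{1/w}(ψ)` and `F ∈ ℋ¹_w(ψ)`. -/
def pairing' {ψ ψd : ι → H} {w : Weight ι} (G : CoorbitInf ψd w⁻¹) (F : CoorbitOne ψ ψd w) : ℂ :=
  conj (pairing F G)

/-- `ℋ¹_w(ψ)` for a frame `ψ` (with its canonical dual frame). -/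
abbrev HOne (ψ : ι → H) (w : Weight ι) : Type _ := CoorbitOne ψ (canonicalDual ψ) w

/-- `ℋ^∞_w(ψ)` for a frame `ψ` (with its canonical dual frame). -/
abbrev HInf (ψ : ι → H) (w : Weight ι) : Type _ := CoorbitInf (canonicalDual ψ) w

end Spaces

/-! ### The tensor product of Hilbert spaces as the space of Hilbert-Schmidt operators -/

section Tensor

variable (H₁ H₂ : Type*) [NormedAddCommGroup H₁] [InnerProductSpace ℂ H₁] [CompleteSpace H₁]
  [NormedAddCommGroup H₂] [InnerProductSpace ℂ H₂]

/-- The index set of some orthonormal basis of `H₁`. -/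
def basisSet : Set H₁ := (exists_hilbertBasis ℂ H₁).choose

/-- Some orthonormal basis of `H₁`. -/
def onb : HilbertBasis (basisSet H₁) ℂ H₁ := (exists_hilbertBasis ℂ H₁).choose_spec.choose

/-- The Hilbert-Schmidt operators `O : H₁ → H₂`, those with `∑ᵢ ‖O eᵢ‖² < ∞`. -/
def hilbertSchmidt : Submodule ℂ (H₁ →L[ℂ] H₂) where
  carrier := {O | Memℓp (fun i => O (onb H₁ i)) 2}
  zero_mem' := zero_memℓp (E := fun _ : basisSet H₁ => H₂) (p := 2)
  add_mem' h h' := Memℓp.add h h'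
  smul_mem' c _ h := Memℓp.const_smul h c

/-- `H₁ ⊗ H₂`, the Hilbert space of Hilbert-Schmidt operators with
`⟨O, O'⟩ = ∑ᵢ ⟨O eᵢ, O' eᵢ⟩`. -/
def HTensor : Type _ := ↥(hilbertSchmidt H₁ H₂)

instance : AddCommGroup (HTensor H₁ H₂) := inferInstanceAs (AddCommGroup ↥(hilbertSchmidt H₁ H₂))

instance : Module ℂ (HTensor H₁ H₂) := inferInstanceAs (Module ℂ ↥(hilbertSchmidt H₁ H₂))

variable {H₁ H₂}

/-- The underlying operator. -/
def HTensor.op (O : HTensor H₁ H₂) : H₁ →L[ℂ] H₂ := Subtype.val O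

variable (H₁ H₂)

/-- `O ↦ (O eᵢ)ᵢ`. -/
def HTensor.toLp : HTensor H₁ H₂ →ₗ[ℂ] lp (fun _ : basisSet H₁ => H₂) 2 where
  toFun O := ⟨fun i => O.op (onb H₁ i), O.2⟩
  map_add' _ _ := rfl
  map_smul' _ _ := rfl

theorem HTensor.toLp_injective : Function.Injective (HTensor.toLp H₁ H₂) := by
  intro O O' h
  apply Subtype.ext
  refine ContinuousLinearMap.ext_on (s := Set.range (onb H₁)) ?_ ?_
  · rw [dense_iff_closure_eq, ← Submodule.topologicalClosure_coe, (onb H₁).dense_span]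
    rfl
  · rintro _ ⟨i, rfl⟩
    exact congrArg (fun x : lp (fun _ : basisSet H₁ => H₂) 2 => x i) h

instance : NormedAddCommGroup (HTensor H₁ H₂) :=
  NormedAddCommGroup.induced _ _ (HTensor.toLp H₁ H₂) (HTensor.toLp_injective H₁ H₂)

instance : NormedSpace ℂ (HTensor H₁ H₂) := NormedSpace.induced ℂ _ _ (HTensor.toLp H₁ H₂)

instance : InnerProductSpace ℂ (HTensor H₁ H₂) where
  inner O O' := ∑' i, inner ℂ (O.op (onb H₁ i)) (O'.op (onb H₁ i))
  norm_sq_eq_re_inner O := by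
    rw [show ‖O‖ = ‖HTensor.toLp H₁ H₂ O‖ from rfl, norm_sq_eq_re_inner (𝕜 := ℂ),
      lp.inner_eq_tsum]
    rfl
  conj_inner_symm O O' :=
    inner_conj_symm (𝕜 := ℂ) (HTensor.toLp H₁ H₂ O) (HTensor.toLp H₁ H₂ O')
  add_left O O' O'' := by
    have := inner_add_left (𝕜 := ℂ) (HTensor.toLp H₁ H₂ O) (HTensor.toLp H₁ H₂ O')
      (HTensor.toLp H₁ H₂ O'')
    rw [← map_add] at this
    exact this
  smul_left O O' c := by
    have := inner_smul_left (𝕜 := ℂ) (HTensor.toLp H₁ H₂ O) (HTensor.toLp H₁ H₂ O') c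
    rw [← map_smul] at this
    exact this

variable {H₁ H₂}

theorem HTensor.inner_def (O O' : HTensor H₁ H₂) :
    inner ℂ O O' = ∑' i, inner ℂ (O.op (onb H₁ i)) (O'.op (onb H₁ i)) := rfl

/-- The simple tensor `f₁ ⊗ f₂`, the operator `f ↦ ⟨f, f₁⟩ f₂`. -/
def simpleTensor (f₁ : H₁) (f₂ : H₂) : HTensor H₁ H₂ :=
  ⟨(innerSL ℂ f₁).smulRight f₂, by
    change Memℓp (fun i => inner ℂ f₁ (onb H₁ i) • f₂) 2
    rw [memℓp_gen_iff (by norm_num)]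
    have h : Summable fun i => ‖f₂‖ ^ 2 * ‖inner ℂ (onb H₁ i) f₁‖ ^ 2 :=
      ((onb H₁).orthonormal.inner_products_summable f₁).mul_left _
    refine h.congr fun i => ?_
    rw [norm_smul, norm_inner_symm]
    simp [mul_pow, mul_comm]⟩

theorem simpleTensor_op (f₁ f : H₁) (f₂ : H₂) :
    (simpleTensor f₁ f₂).op f = inner ℂ f₁ f • f₂ := rfl

/-- `⟨O, f₁ ⊗ f₂⟩ = ⟨O f₁, f₂⟩`. -/
theorem inner_simpleTensor (f₁ : H₁) (f₂ : H₂) (O : HTensor H₁ H₂) :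
    inner ℂ (simpleTensor f₁ f₂) O = inner ℂ f₂ (O.op f₁) := by
  rw [HTensor.inner_def]
  have h := (onb H₁).hasSum_repr f₁
  have h' := (h.mapL O.op).mapL (innerSL ℂ f₂)
  refine HasSum.tsum_eq ?_
  refine h'.congr_fun fun i => ?_
  simp [simpleTensor_op, HilbertBasis.repr_apply_apply, mul_comm]

theorem inner_simpleTensor_simpleTensor (f₁ g₁ : H₁) (f₂ g₂ : H₂) :
    inner ℂ (simpleTensor f₁ f₂) (simpleTensor g₁ g₂) =
      conj (inner ℂ f₁ g₁) * inner ℂ f₂ g₂ := by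
  rw [inner_simpleTensor, simpleTensor_op, inner_smul_right, inner_conj_symm]

/-- The family `ψ₁ ⊗ ψ₂ = (ψ_{1,i} ⊗ ψ_{2,j})_{i,j}`. -/
def tensorFamily {I J : Type*} (ψ₁ : I → H₁) (ψ₂ : J → H₂) : I × J → HTensor H₁ H₂ :=
  fun p => simpleTensor (ψ₁ p.1) (ψ₂ p.2)

/-- `ℋ^{1,1}_{w₁⊗w₂}(ψ₁ ⊗ ψ₂)`; the canonical dual frame of `ψ₁ ⊗ ψ₂` is the tensor product of the
canonical dual frames. -/
abbrev HOneTensor {I J : Type*} (ψ₁ : I → H₁) (ψ₂ : J → H₂) (w₁ : Weight I) (w₂ : Weight J) :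
    Type _ :=
  CoorbitOne (tensorFamily ψ₁ ψ₂) (tensorFamily (canonicalDual ψ₁) (canonicalDual ψ₂))
    (tensorWeight w₁ w₂)

/-- `ℋ^{∞,∞}_{1/(w₁⊗w₂)}(ψ₁ ⊗ ψ₂)`. -/
abbrev HInfTensor {I J : Type*} (ψ₁ : I → H₁) (ψ₂ : J → H₂) (w₁ : Weight I) (w₂ : Weight J) :
    Type _ :=
  CoorbitInf (tensorFamily (canonicalDual ψ₁) (canonicalDual ψ₂)) (tensorWeight w₁ w₂)⁻¹

theorem infSeq_tensor {I J : Type*} {φ₁ : I → H₁} {φ₂ : J → H₂} {w₁ : Weight I} {w₂ : Weight J}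
    (F : infSeq φ₁ w₁⁻¹) (G : infSeq φ₂ w₂⁻¹) :
    (fun n => simpleTensor (F.1 n) (G.1 n)) ∈
      infSeq (tensorFamily φ₁ φ₂) (tensorWeight w₁ w₂)⁻¹ := by
  obtain ⟨M, hM⟩ := F.2.2
  obtain ⟨N, hN⟩ := G.2.2
  refine ⟨fun p => ?_, M * N, fun n p => ?_⟩
  · obtain ⟨k, hk⟩ := F.2.1 p.1
    obtain ⟨l, hl⟩ := G.2.1 p.2
    refine ⟨conj k * l, ?_⟩
    simp only [tensorFamily, inner_simpleTensor_simpleTensor]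
    exact ((Complex.continuous_conj.tendsto k).comp hk).mul hl
  · have h1 := hM n p.1
    have h2 := hN n p.2
    have h3 : 0 ≤ ((w₁⁻¹ p.1 : {x : ℝ // 0 < x}) : ℝ) * ‖inner ℂ (φ₁ p.1) (F.1 n)‖ :=
      mul_nonneg (w₁⁻¹ p.1).2.le (norm_nonneg _)
    have h4 : 0 ≤ ((w₂⁻¹ p.2 : {x : ℝ // 0 < x}) : ℝ) * ‖inner ℂ (φ₂ p.2) (G.1 n)‖ :=
      mul_nonneg (w₂⁻¹ p.2).2.le (norm_nonneg _)
    have h5 := mul_le_mul h1 h2 h4 (h3.trans h1)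
    simp only [tensorFamily, inner_simpleTensor_simpleTensor, norm_mul, RCLike.norm_conj,
      tensorWeight, Pi.inv_apply, mul_inv] at h5 ⊢
    refine le_trans (le_of_eq ?_) h5
    rw [Positive.val_mul]
    ring

/-- The simple tensor `f₁ ⊗ f₂ ∈ ℋ^{∞,∞}_{1/(w₁⊗w₂)}` of `f₁ ∈ ℋ^∞_{1/w₁}` and
`f₂ ∈ ℋ^∞_{1/w₂}`: the class of `(f_{1,n} ⊗ f_{2,n})_n` where `f₁ = [(f_{1,n})]`,
`f₂ = [(f_{2,n})]`. -/
def infTensor {I J : Type*} {φ₁ : I → H₁} {φ₂ : J → H₂} {w₁ : Weight I} {w₂ : Weight J}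
    (f₁ : CoorbitInf φ₁ w₁⁻¹) (f₂ : CoorbitInf φ₂ w₂⁻¹) :
    CoorbitInf (tensorFamily φ₁ φ₂) (tensorWeight w₁ w₂)⁻¹ :=
  CoorbitInf.mk ⟨_, infSeq_tensor f₁.rep f₂.rep⟩

theorem CoorbitInf.coef_mk {ι H : Type*} [NormedAddCommGroup H] [InnerProductSpace ℂ H]
    {ψd : ι → H} {w : Weight ι} (F : infSeq ψd w) (i : ι) :
    CoorbitInf.coef ψd w (CoorbitInf.mk F) i = limUnder atTop fun n => inner ℂ (ψd i) (F.1 n) :=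
  rfl

theorem CoorbitInf.mk_rep {ι H : Type*} [NormedAddCommGroup H] [InnerProductSpace ℂ H]
    {ψd : ι → H} {w : Weight ι} (F : CoorbitInf ψd w) : CoorbitInf.mk F.rep = F :=
  Quotient.out_eq F

/-- The class `f₁ ⊗ f₂` does not depend on the representing sequences. -/
theorem infTensor_mk {I J : Type*} {φ₁ : I → H₁} {φ₂ : J → H₂} {w₁ : Weight I} {w₂ : Weight J}
    (F : infSeq φ₁ w₁⁻¹) (G : infSeq φ₂ w₂⁻¹) :
    infTensor (CoorbitInf.mk F) (CoorbitInf.mk G) = CoorbitInf.mk ⟨_, infSeq_tensor F G⟩ := by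
  have key : ∀ (F : infSeq φ₁ w₁⁻¹) (G : infSeq φ₂ w₂⁻¹) (p : I × J),
      CoorbitInf.coef _ _ (CoorbitInf.mk ⟨_, infSeq_tensor F G⟩) p =
        conj (CoorbitInf.coef φ₁ w₁⁻¹ (CoorbitInf.mk F) p.1) *
          CoorbitInf.coef φ₂ w₂⁻¹ (CoorbitInf.mk G) p.2 := by
    intro F G p
    rw [CoorbitInf.coef_mk, CoorbitInf.coef_mk, CoorbitInf.coef_mk]
    refine Tendsto.limUnder_eq ?_
    simp only [tensorFamily, inner_simpleTensor_simpleTensor]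
    exact ((Complex.continuous_conj.tendsto _).comp (infSeq_tendsto F p.1)).mul
      (infSeq_tendsto G p.2)
  refine CoorbitInf.coef_injective _ _ (funext fun p => ?_)
  rw [infTensor, key, key, CoorbitInf.mk_rep, CoorbitInf.mk_rep]

end Tensor

/-! ### The operators with a kernel -/

section Operators

variable {I J H₁ H₂ : Type*} [NormedAddCommGroup H₁] [InnerProductSpace ℂ H₁]
  [NormedAddCommGroup H₂] [InnerProductSpace ℂ H₂]

/-- `O = ∑ᵣ ⟨·, f_r⟩ g_r` with `∑ᵣ ‖f_r‖ ‖g_r‖ < ∞`. -/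
def Represents {ψ₁ : I → H₁} {ψ₂ : J → H₂} {w₁ : Weight I} {w₂ : Weight J}
    (f : ℕ → HOne ψ₁ w₁) (g : ℕ → HOne ψ₂ w₂) (O : HInf ψ₁ w₁⁻¹ →L[ℂ] HOne ψ₂ w₂) : Prop :=
  Summable (fun r => ‖f r‖ * ‖g r‖) ∧ ∀ h, HasSum (fun r => pairing' h (f r) • g r) (O h)

/-- The space `𝓑` of bounded operators `O = ∑ᵣ ⟨·, f_r⟩ g_r`, `f_r ∈ ℋ¹_{w₁}(ψ₁)`,
`g_r ∈ ℋ¹_{w₂}(ψ₂)`, `∑ᵣ ‖f_r‖ ‖g_r‖ < ∞`. -/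
def kernelOperators (ψ₁ : I → H₁) (ψ₂ : J → H₂) (w₁ : Weight I) (w₂ : Weight J) :
    Submodule ℂ (HInf ψ₁ w₁⁻¹ →L[ℂ] HOne ψ₂ w₂) where
  carrier := {O | ∃ f g, Represents f g O}
  zero_mem' := ⟨0, 0, by simp [summable_zero], fun h => by simp [hasSum_zero]⟩
  add_mem' := by
    rintro O O' ⟨f, g, hs, hO⟩ ⟨f', g', hs', hO'⟩
    let e := Equiv.natSumNatEquivNat.symm
    refine ⟨fun r => Sum.elim f f' (e r), fun r => Sum.elim g g' (e r), ?_, fun h => ?_⟩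
    · refine (e.summable_iff (f := fun s => ‖Sum.elim f f' s‖ * ‖Sum.elim g g' s‖)).2 ?_
      exact (HasSum.sum (f := fun s => ‖Sum.elim f f' s‖ * ‖Sum.elim g g' s‖)
        hs.hasSum hs'.hasSum).summable
    · refine (e.hasSum_iff (f := fun s => pairing' h (Sum.elim f f' s) • Sum.elim g g' s)).2 ?_
      exact HasSum.sum (f := fun s => pairing' h (Sum.elim f f' s) • Sum.elim g g' s)
        (hO h) (hO' h)
  smul_mem' := by
    rintro c O ⟨f, g, hs, hO⟩
    refine ⟨f, fun r => c • g r, ?_, fun h => ?_⟩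
    · refine (hs.mul_left ‖c‖).congr fun r => ?_
      rw [norm_smul]
      ring
    · refine ((hO h).const_smul c).congr_fun fun r => ?_
      rw [smul_comm]

/-- The norm of `𝓑`: the infimum of `∑ᵣ ‖f_r‖ ‖g_r‖` over all representations of `O`. -/
def kernelOperatorNorm {ψ₁ : I → H₁} {ψ₂ : J → H₂} {w₁ : Weight I} {w₂ : Weight J}
    (O : HInf ψ₁ w₁⁻¹ →L[ℂ] HOne ψ₂ w₂) : ℝ :=
  sInf {s | ∃ f g, Represents f g O ∧ s = ∑' r, ‖f r‖ * ‖g r‖}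

end Operators

end Coorbit

end

/-!
Write `G = (⟨ψ_{i'}, ψ_i⟩)` for the Gram matrix of a localised frame `ψ`, `ψ̃` for the canonical dual
frame, and `C` for the analysis operator, so that `G = C C*` and the frame operator is `S = C* C`.

*Localisation of the dual frame.* The Gram matrix of `ψ̃` is `C S⁻² C*`, the pseudo-inverse of `G`, and
the cross Gram matrix of `ψ` and `ψ̃` is `P = C S⁻¹ C*`, the projection on the range of `G`. Both
belong to the algebra `𝒜` (`SpectralMatrixAlgebra.pseudoInverse_mem`). Indeed, `0` is at most an
isolated point of the spectrum of `G`, and `1 - P` is the contour integral of `(z - G)⁻¹` around `0`.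
Since `𝒜` is inverse-closed, the resolvent takes values in the unitization of `𝒜`; there the integral
converges as well, because the inclusion of `𝒜` in `B(ℓ²)` is continuous. Then
`(G + (1 - P))⁻¹ = G† + (1 - P)` lies in `ℂ 1 + 𝒜`; its product with `G ∈ 𝒜` is `P`, and the product
with `P` is `G†`.

*Duality.* Admissibility, for `p = 1`, turns these memberships into weighted bounds for the columns
of the three Gram matrices. They are collected, with the reconstruction formulas of the frame, in
`IsRegular`. This is all that the duality of `ℋ¹_w` and `ℋ^∞_{1/w}` needs: by dominated convergence
`(C_ψ F)_i = lim ⟨F_n, ψ_i⟩` exists and depends only on the class of `(F_n)`, the pairing is bounded,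
`⟨ψ_k, G⟩ = conj (C_ψ G)_k`, and the pairings of `F ∈ ℋ¹_w` with the vectors `ψ̃_k ∈ ℋ^∞_{1/w}` are
the coefficients of `F`, so that they determine `F` (`IsRegular.ext_pairing`). Regularity passes to
tensor products (`IsRegular.tensor`), so that the same holds for `ℋ^{1,1}` and `ℋ^{∞,∞}`.

*Kernels.* The relation `⟨K, f₁ ⊗ f₂⟩ = ⟨O f₁, f₂⟩`, tested on the vectors `ψ̃_{1,i}` and `ψ̃_{2,j}`,
determines each of `K` and `O` from the other. If `K` has the coefficients `K_{i,j}`, then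
`O = ∑ K_{i,j} ⟨·, ψ_{1,i}⟩ ψ_{2,j}` converges absolutely and has the kernel `K`
(`exists_operator_of_kernel`); conversely `O = ∑ ⟨·, f_r⟩ g_r` has the kernel `∑ f_r ⊗ g_r`
(`exists_kernel_of_represents`). Both constructions are bounded, which gives the equivalence of the
norms.
-/

noncomputable section

namespace Coorbit

/-! ### Holomorphic functional calculus in a spectral matrix algebra -/

section Contour

variable {U B : Type*} [NormedRing U] [NormedAlgebra ℂ U] [CompleteSpace U]
  [NormedRing B] [NormedAlgebra ℂ B]

/-- If `E` inverts `G` on the range of the idempotent `P`, then for small `z ≠ 0` the resolvent of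
`G` is `z⁻¹ (1 - P) - E (1 - z E)⁻¹`. -/
theorem resolvent_of_pseudoInverse {G E P : B} (hGE : G * E = P) (hEG : E * G = P)
    (hGP : G * P = G) (hPG : P * G = G) (hPE : P * E = E) (hEP : E * P = E)
    {z : ℂ} (hz : z ≠ 0) (hu : IsUnit (1 - z • E)) :
    z ∈ resolventSet ℂ G ∧
      resolvent G z = z⁻¹ • (1 - P - (z • E) * Ring.inverse (1 - z • E)) := by
  set V := Ring.inverse (1 - z • E) with hV
  have h1 : (1 - z • E) * V = 1 := Ring.mul_inverse_cancel _ hu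
  have h2 : V * (1 - z • E) = 1 := Ring.inverse_mul_cancel _ hu
  have hEV : E * V = V * E := by
    have hc : (1 - z • E) * E = E * (1 - z • E) := by
      simp [sub_mul, mul_sub]
    calc E * V = V * (1 - z • E) * E * V := by rw [h2, one_mul]
      _ = V * E * ((1 - z • E) * V) := by rw [mul_assoc V, hc]; simp only [mul_assoc]
      _ = V * E := by rw [h1, mul_one]
  set N := z⁻¹ • (1 - P - (z • E) * V) with hN
  have hN' : N = z⁻¹ • (1 - P) - E * V := by
    rw [hN, smul_sub, smul_mul_assoc, smul_smul, inv_mul_cancel₀ hz, one_smul]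
  have hzG : algebraMap ℂ B z = z • (1 : B) := Algebra.algebraMap_eq_smul_one z
  have hr : (algebraMap ℂ B z - G) * N = 1 := by
    have e1 : (algebraMap ℂ B z - G) * (z⁻¹ • (1 - P)) = 1 - P := by
      rw [hzG, sub_mul, smul_mul_smul_comm, mul_inv_cancel₀ hz, one_mul, one_smul,
        mul_smul_comm, mul_sub, mul_one, hGP, sub_self, smul_zero, sub_zero]
    have e2 : (algebraMap ℂ B z - G) * (E * V) = -P := by
      have : (algebraMap ℂ B z - G) * E = -(P * (1 - z • E)) := by
        rw [hzG, sub_mul, hGE, mul_sub, mul_one, mul_smul_comm, hPE, smul_mul_assoc, one_mul]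
        abel
      rw [← mul_assoc, this, neg_mul, mul_assoc, h1, mul_one]
    rw [hN', mul_sub, e1, e2]
    abel
  have hl : N * (algebraMap ℂ B z - G) = 1 := by
    have e1 : (z⁻¹ • (1 - P)) * (algebraMap ℂ B z - G) = 1 - P := by
      rw [hzG, mul_sub, smul_mul_smul_comm, inv_mul_cancel₀ hz, mul_one, one_smul,
        smul_mul_assoc, sub_mul, one_mul, hPG, sub_self, smul_zero, sub_zero]
    have e2 : (E * V) * (algebraMap ℂ B z - G) = -P := by
      have : E * (algebraMap ℂ B z - G) = -((1 - z • E) * P) := by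
        rw [hzG, mul_sub, hEG, sub_mul, one_mul, smul_mul_assoc, hEP, mul_smul_comm, mul_one]
        abel
      rw [hEV, mul_assoc, this, mul_neg, ← mul_assoc, h2, one_mul]
    rw [hN', sub_mul, e1, e2]
    abel
  have hunit : IsUnit (algebraMap ℂ B z - G) := ⟨⟨_, N, hr, hl⟩, rfl⟩
  refine ⟨hunit, ?_⟩
  have := Ring.inverse_mul_cancel _ hunit
  calc resolvent G z = Ring.inverse (algebraMap ℂ B z - G) * ((algebraMap ℂ B z - G) * N) := by
        rw [hr, mul_one]; rfl
    _ = N := by rw [← mul_assoc, this, one_mul]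

/-- Riesz projection: let `φ : U → B` be a continuous homomorphism of Banach algebras that reflects
invertibility of `z - g` for `z ≠ 0`. If `0` is at most an isolated point of the spectrum of `φ g`
and `E` inverts `φ g` on the range of the complementary idempotent `P`, then `1 - P` is the image of
the contour integral of the resolvent of `g` around `0`. -/
theorem exists_map_eq_one_sub_idempotent [CompleteSpace B] (φ : U →ₐ[ℂ] B) (hφ : Continuous φ) (g : U)
    (hg : ∀ z : ℂ, z ≠ 0 → z ∈ resolventSet ℂ (φ g) → z ∈ resolventSet ℂ g)
    {E P : B} (hGE : φ g * E = P) (hEG : E * φ g = P)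
    (hGP : φ g * P = φ g) (hPG : P * φ g = φ g) (hPE : P * E = E) (hEP : E * P = E) :
    ∃ u, φ u = 1 - P := by
  obtain ⟨R, hR, hRE⟩ : ∃ R : ℝ, 0 < R ∧ ∀ z : ℂ, z ∈ Metric.closedBall (0 : ℂ) R →
      IsUnit (1 - z • E) := by
    have hc : Continuous fun z : ℂ => 1 - z • E := by fun_prop
    have h0 : {z : ℂ | IsUnit (1 - z • E)} ∈ 𝓝 (0 : ℂ) :=
      (Units.isOpen.preimage hc).mem_nhds (by simp)
    obtain ⟨R, hR, h⟩ := Metric.nhds_basis_closedBall.mem_iff.1 h0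
    exact ⟨R, hR, fun z hz => h hz⟩
  have hsph : ∀ z ∈ Metric.sphere (0 : ℂ) R, z ≠ 0 := by
    rintro z hz rfl
    simp at hz
    exact hR.ne hz
  have hres : ∀ z ∈ Metric.sphere (0 : ℂ) R, z ∈ resolventSet ℂ (φ g) ∧
      resolvent (φ g) z = z⁻¹ • (1 - P - (z • E) * Ring.inverse (1 - z • E)) := fun z hz =>
    resolvent_of_pseudoInverse hGE hEG hGP hPG hPE hEP (hsph z hz)
      (hRE z (Metric.sphere_subset_closedBall hz))
  have hresg : ∀ z ∈ Metric.sphere (0 : ℂ) R, z ∈ resolventSet ℂ g := fun z hz =>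
    hg z (hsph z hz) (hres z hz).1
  have hcont : ContinuousOn (fun z => resolvent g z) (Metric.sphere (0 : ℂ) R) := fun z hz =>
    (spectrum.hasDerivAt_resolvent_const_left (hresg z hz)).continuousAt.continuousWithinAt
  let Φ : U →L[ℂ] B := ⟨φ.toLinearMap, hφ⟩
  have hmap : Φ (∮ z in C(0, R), resolvent g z) = ∮ z in C(0, R), Φ (resolvent g z) := by
    rw [circleIntegral, circleIntegral, ← ContinuousLinearMap.intervalIntegral_comp_comm]
    · simp only [map_smul]
    · exact (hcont.circleIntegrable hR.le).out
  have hcongr : (∮ z in C(0, R), Φ (resolvent g z)) =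
      ∮ z in C(0, R), (z - 0)⁻¹ • (1 - P - (z • E) * Ring.inverse (1 - z • E)) := by
    refine circleIntegral.integral_congr hR.le fun z hz => ?_
    simp only [sub_zero]
    rw [← (hres z hz).2]
    have h1 : (algebraMap ℂ B z - φ g) * φ (resolvent g z) = 1 := by
      have := Ring.mul_inverse_cancel _ (hresg z hz)
      have := congrArg φ this
      simpa [resolvent] using this
    have h2 := Ring.inverse_mul_cancel _ (hres z hz).1
    calc φ (resolvent g z) = resolvent (φ g) z * (algebraMap ℂ B z - φ g) * φ (resolvent g z) := by
          rw [resolvent.eq_1 (φ g), h2, one_mul]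
      _ = resolvent (φ g) z := by rw [mul_assoc, h1, mul_one]
  have hdiff : DifferentiableOn ℂ (fun z : ℂ => 1 - P - (z • E) * Ring.inverse (1 - z • E))
      (Metric.closedBall (0 : ℂ) R) := by
    intro z hz
    have hi : DifferentiableAt ℂ (fun z : ℂ => Ring.inverse (1 - z • E)) z := by
      refine DifferentiableAt.comp (g := Ring.inverse) z ?_ (by fun_prop)
      exact (hasFDerivAt_ringInverse (𝕜 := ℂ) (hRE z hz).unit).differentiableAt
    have hE : DifferentiableAt ℂ (fun z : ℂ => z • E) z := by fun_prop
    exact ((differentiableAt_const _).sub (hE.mul hi)).differentiableWithinAt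
  have hC := hdiff.circleIntegral_sub_inv_smul (w := 0) (by simpa using hR)
  rw [← hcongr, ← hmap] at hC
  refine ⟨(2 * Real.pi * Complex.I : ℂ)⁻¹ • ∮ z in C(0, R), resolvent g z, ?_⟩
  rw [map_smul]
  change _ • Φ _ = _
  rw [hC, smul_smul, inv_mul_cancel₀ Complex.two_pi_I_ne_zero]
  simp

end Contour

namespace SpectralMatrixAlgebra

variable {I : Type*} (𝒜 : SpectralMatrixAlgebra I)

/-- The members of a spectral matrix algebra, as a type which carries the norm of the algebra (and
not the operator norm). -/
def Elem : Type _ := ↥𝒜.carrier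

instance : NonUnitalRing 𝒜.Elem := inferInstanceAs (NonUnitalRing ↥𝒜.carrier)
instance : Module ℂ 𝒜.Elem := inferInstanceAs (Module ℂ ↥𝒜.carrier)
instance : IsScalarTower ℂ 𝒜.Elem 𝒜.Elem := inferInstanceAs (IsScalarTower ℂ 𝒜.carrier 𝒜.carrier)
instance : SMulCommClass ℂ 𝒜.Elem 𝒜.Elem := inferInstanceAs (SMulCommClass ℂ 𝒜.carrier 𝒜.carrier)

instance : NormedAddCommGroup 𝒜.Elem := AddGroupNorm.toNormedAddCommGroup
  { toFun := fun A => 𝒜.norm A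
    map_zero' := map_zero 𝒜.norm
    add_le' := map_add_le_add 𝒜.norm
    neg' := map_neg_eq_map 𝒜.norm
    eq_zero_of_map_eq_zero' := 𝒜.eq_zero_of_norm }

instance : NonUnitalNormedRing 𝒜.Elem where
  dist_eq := dist_eq_norm_neg_add
  norm_mul_le := 𝒜.norm_mul_le

instance : NormedSpace ℂ 𝒜.Elem where
  norm_smul_le c A := (map_smul_eq_mul 𝒜.norm c A).le

instance : CompleteSpace 𝒜.Elem := by
  refine Metric.complete_of_cauchySeq_tendsto fun u hu => ?_
  obtain ⟨A, hA⟩ := 𝒜.complete u fun ε hε => by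
    obtain ⟨N, hN⟩ := Metric.cauchySeq_iff.1 hu ε hε
    exact ⟨N, fun m hm n hn => by
      have := hN m hm n hn
      rwa [dist_eq_norm] at this⟩
  exact ⟨A, tendsto_iff_norm_sub_tendsto_zero.2 hA⟩

/-- The unitization `ℂ ⊕ 𝒜`, a Banach algebra. -/
abbrev Unital : Type _ := WithLp 1 (Unitization ℂ 𝒜.Elem)

/-- The inclusion of the algebra in `B(ℓ²(I))`. -/
def inclusion : 𝒜.Elem →ₙₐ[ℂ] (Ell2 I →L[ℂ] Ell2 I) where
  toFun A := Subtype.val A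
  map_smul' _ _ := rfl
  map_zero' := rfl
  map_add' _ _ := rfl
  map_mul' _ _ := rfl

/-- The homomorphism `(c, A) ↦ c 1 + A` from the unitization to `B(ℓ²(I))`. -/
def unitalMap : 𝒜.Unital →ₐ[ℂ] (Ell2 I →L[ℂ] Ell2 I) :=
  (Unitization.lift 𝒜.inclusion).comp (WithLp.unitizationAlgEquiv ℂ).toAlgHom

theorem unitalMap_apply (u : 𝒜.Unital) :
    𝒜.unitalMap u = (WithLp.ofLp u).fst • 1 + 𝒜.inclusion (WithLp.ofLp u).snd := by
  rw [← Algebra.algebraMap_eq_smul_one]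
  rfl

/-- A member of the algebra, in the unitization. -/
def toUnital (A : 𝒜.Elem) : 𝒜.Unital := WithLp.toLp 1 (A : Unitization ℂ 𝒜.Elem)

theorem unitalMap_toUnital (A : 𝒜.Elem) : 𝒜.unitalMap (𝒜.toUnital A) = 𝒜.inclusion A := by
  rw [unitalMap_apply]
  simp [toUnital]

/-- Inverse-closedness passes to the unitization: for `z ≠ 0`, if `z - A` is invertible in
`B(ℓ²(I))` with inverse `T`, then `T - z⁻¹ = z⁻¹ T A` belongs to `𝒜`. -/
theorem mem_resolventSet_toUnital (A : 𝒜.Elem) {z : ℂ} (hz : z ≠ 0)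
    (h : z ∈ resolventSet ℂ (𝒜.unitalMap (𝒜.toUnital A))) :
    z ∈ resolventSet ℂ (𝒜.toUnital A) := by
  rw [unitalMap_toUnital] at h
  obtain ⟨⟨X, T, h1, h2⟩, hX⟩ := h
  simp only at hX
  subst hX
  rw [Algebra.algebraMap_eq_smul_one] at h1 h2
  set a : Ell2 I →L[ℂ] Ell2 I := 𝒜.inclusion A with ha
  have hmem : -a ∈ 𝒜.carrier := neg_mem A.2
  obtain ⟨d, B, hB, hT⟩ := 𝒜.inverse_closed z (-a) hmem T
    (by rw [← sub_eq_add_neg]; exact h1) (by rw [← sub_eq_add_neg]; exact h2)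
  have hTa : T * a ∈ 𝒜.carrier := by
    rw [hT, add_mul, smul_mul_assoc, one_mul]
    exact add_mem (SMulMemClass.smul_mem d A.2) (mul_mem hB A.2)
  have haT : a * T = T * a := by
    have : z • T - a * T = z • T - T * a := by
      rw [sub_mul, smul_mul_assoc, one_mul] at h1
      rw [mul_sub, mul_smul_comm, mul_one] at h2
      rw [h1, h2]
    exact sub_right_injective this
  have hTz : z⁻¹ • (T * a) + z⁻¹ • 1 = T := by
    have : z • T = T * a + 1 := by
      rw [mul_sub, mul_smul_comm, mul_one] at h2
      rw [← h2]; abel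
    rw [← smul_add, ← this, smul_smul, inv_mul_cancel₀ hz, one_smul]
  let D : 𝒜.Elem := ⟨z⁻¹ • (T * a), SMulMemClass.smul_mem _ hTa⟩
  have e1 : z • D - z⁻¹ • A - A * D = 0 := by
    apply Subtype.ext
    change z • z⁻¹ • (T * a) - z⁻¹ • a - a * (z⁻¹ • (T * a)) = 0
    have : z⁻¹ • a + a * (z⁻¹ • (T * a)) = T * a := by
      have h3 : a * (z⁻¹ • (T * a) + z⁻¹ • 1) = T * a := by rw [hTz, haT]
      rwa [mul_add, mul_smul_comm z⁻¹ a 1, mul_one, add_comm] at h3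
    rw [smul_smul, mul_inv_cancel₀ hz, one_smul, sub_sub, this, sub_self]
  have e2 : z • D - z⁻¹ • A - D * A = 0 := by
    apply Subtype.ext
    change z • z⁻¹ • (T * a) - z⁻¹ • a - (z⁻¹ • (T * a)) * a = 0
    have : z⁻¹ • a + (z⁻¹ • (T * a)) * a = T * a := by
      have h3 : (z⁻¹ • (T * a) + z⁻¹ • 1) * a = T * a := by rw [hTz]
      rwa [add_mul, smul_mul_assoc z⁻¹ 1 a, one_mul, add_comm] at h3
    rw [smul_smul, mul_inv_cancel₀ hz, one_smul, sub_sub, this, sub_self]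
  let V : Unitization ℂ 𝒜.Elem := Unitization.inl z⁻¹ + (D : Unitization ℂ 𝒜.Elem)
  have hW : algebraMap ℂ (Unitization ℂ 𝒜.Elem) z - (A : Unitization ℂ 𝒜.Elem) =
      Unitization.inl z + ((-A : 𝒜.Elem) : Unitization ℂ 𝒜.Elem) := by
    rw [Unitization.inr_neg, sub_eq_add_neg, Unitization.algebraMap_eq_inl]
  have key : IsUnit (algebraMap ℂ (Unitization ℂ 𝒜.Elem) z - (A : Unitization ℂ 𝒜.Elem)) := by
    rw [hW]
    refine ⟨⟨_, V, ?_, ?_⟩, rfl⟩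
    · refine Unitization.ext ?_ ?_
      · simp [V, hz]
      · refine Eq.trans ?_ e1
        simp [V, sub_eq_add_neg]
    · refine Unitization.ext ?_ ?_
      · simp [V, hz]
      · refine Eq.trans ?_ e2
        simp [V, sub_eq_add_neg, add_comm (z • D)]
  exact key.map (WithLp.unitizationAlgEquiv (𝕜 := ℂ) (A := 𝒜.Elem) ℂ).symm

instance : NormOneClass 𝒜.Unital where
  norm_one := by
    rw [WithLp.unitization_norm_def]
    have : WithLp.ofLp (1 : 𝒜.Unital) = 1 := rfl
    simp [this]

/-- The inclusion of a Banach `*`-algebra in a `C*`-algebra is contractive: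
`‖A‖² = ‖A* A‖` is the spectral radius of `A* A`, which is at most `‖A* A‖_𝒜 ≤ ‖A‖_𝒜²`. -/
theorem norm_inclusion_le (A : 𝒜.Elem) : ‖𝒜.inclusion A‖ ≤ ‖A‖ := by
  let S : 𝒜.Elem := (star (show 𝒜.carrier from A) : 𝒜.carrier)
  have hS : ‖S‖ = ‖A‖ := 𝒜.norm_star A
  have hinc : 𝒜.inclusion (S * A) = star (𝒜.inclusion A) * 𝒜.inclusion A := rfl
  have h1 : (‖𝒜.inclusion (S * A)‖₊ : ℝ≥0∞) ≤ ‖𝒜.toUnital (S * A)‖₊ := by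
    have hsa : IsSelfAdjoint (𝒜.inclusion (S * A)) := by
      rw [hinc]; exact .star_mul_self _
    rw [← hsa.spectralRadius_eq_nnnorm, ← unitalMap_toUnital]
    refine le_trans ?_ (spectrum.spectralRadius_le_nnnorm (𝕜 := ℂ) (𝒜.toUnital (S * A)))
    exact iSup₂_mono' fun z hz => ⟨z, AlgHom.spectrum_apply_subset _ _ hz, le_rfl⟩
  have h2 : ‖𝒜.inclusion (S * A)‖ ≤ ‖S * A‖ := by
    have : ‖𝒜.inclusion (S * A)‖₊ ≤ ‖𝒜.toUnital (S * A)‖₊ := by exact_mod_cast h1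
    rw [toUnital, WithLp.unitization_nnnorm_inr] at this
    exact this
  have h3 : ‖𝒜.inclusion A‖ * ‖𝒜.inclusion A‖ ≤ ‖A‖ * ‖A‖ := by
    rw [← CStarRing.norm_star_mul_self, ← hinc]
    refine h2.trans ((_root_.norm_mul_le S A).trans ?_)
    rw [hS]
  exact (mul_self_le_mul_self_iff (norm_nonneg _) (norm_nonneg _)).2 h3

theorem continuous_unitalMap : Continuous 𝒜.unitalMap := by
  refine AddMonoidHomClass.continuous_of_bound 𝒜.unitalMap 1 fun u => ?_
  rw [unitalMap_apply, WithLp.unitization_norm_def, one_mul]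
  refine (norm_add_le _ _).trans (add_le_add ?_ (𝒜.norm_inclusion_le _))
  rw [norm_smul]
  exact mul_le_of_le_one_right (norm_nonneg _) ContinuousLinearMap.norm_id_le

/-- A spectral matrix algebra contains the pseudo-inverse `E` of each of its members `G` that has
one, and the projection `P = G E`. -/
theorem pseudoInverse_mem {G E P : Ell2 I →L[ℂ] Ell2 I} (hG : G ∈ 𝒜.carrier)
    (hGE : G * E = P) (hEG : E * G = P) (hGP : G * P = G) (hPG : P * G = G)
    (hPE : P * E = E) (hEP : E * P = E) : P ∈ 𝒜.carrier ∧ E ∈ 𝒜.carrier := by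
  have hPP : P * P = P := by nth_rw 2 [← hGE]; rw [← mul_assoc, hPG, hGE]
  let g : 𝒜.Elem := ⟨G, hG⟩
  have hφ : 𝒜.unitalMap (𝒜.toUnital g) = G := 𝒜.unitalMap_toUnital g
  obtain ⟨u, hu⟩ := exists_map_eq_one_sub_idempotent 𝒜.unitalMap 𝒜.continuous_unitalMap
    (𝒜.toUnital g) (fun z => 𝒜.mem_resolventSet_toUnital g) (E := E) (P := P)
    (by rw [hφ, hGE]) (by rw [hφ, hEG]) (by rw [hφ, hGP]) (by rw [hφ, hPG]) hPE hEP
  rw [unitalMap_apply] at hu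
  set c := (WithLp.ofLp u).fst
  set X : 𝒜.Elem := (WithLp.ofLp u).snd
  have hX : 𝒜.inclusion X ∈ 𝒜.carrier := X.2
  -- `G + (1 - P)` is invertible with inverse `E + (1 - P)`.
  obtain ⟨d, B, hB, hT⟩ := 𝒜.inverse_closed c (G + 𝒜.inclusion X) (add_mem hG hX) (E + (1 - P))
    (by
      rw [add_left_comm, hu]
      simp only [add_mul, mul_add, mul_sub, sub_mul, mul_one, one_mul, hGE, hGP, hPE, hPP]
      abel)
    (by
      rw [add_left_comm, hu]
      simp only [add_mul, mul_add, mul_sub, sub_mul, mul_one, one_mul, hEG, hEP, hPG, hPP]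
      abel)
  have hPmem : P ∈ 𝒜.carrier := by
    have : (E + (1 - P)) * G = P := by
      rw [add_mul, sub_mul, one_mul, hEG, hPG, sub_self, add_zero]
    rw [← this, hT, add_mul, smul_mul_assoc, one_mul]
    exact add_mem (SMulMemClass.smul_mem d hG) (mul_mem hB hG)
  refine ⟨hPmem, ?_⟩
  have : (E + (1 - P)) * P = E := by
    rw [add_mul, sub_mul, one_mul, hEP, hPP, sub_self, add_zero]
  rw [← this, hT, add_mul, smul_mul_assoc, one_mul]
  exact add_mem (SMulMemClass.smul_mem d hPmem) (mul_mem hB hPmem)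

end SpectralMatrixAlgebra

/-! ### Frames and their localisation -/

section Entry

variable {I : Type*}

open Classical in
theorem ext_entry {S T : Ell2 I →L[ℂ] Ell2 I} (h : ∀ i j, entry S i j = entry T i j) : S = T := by
  ext x : 1
  have hx := lp.hasSum_single (by norm_num : (2 : ℝ≥0∞) ≠ ⊤) x
  refine (hx.mapL S).unique ((hx.mapL T).congr_fun fun j => ?_)
  have hj : lp.single 2 j (x j) = x j • (lp.single 2 j (1 : ℂ) : Ell2 I) := by
    rw [← lp.single_smul, smul_eq_mul, mul_one]
  rw [hj, map_smul, map_smul]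
  congr 1
  ext i
  exact h i j

/-- The columns of a member of `𝒜`, in the `ℓ¹_w` norm: admissibility for `p = 1`, applied to the
unit vectors. -/
theorem Admissible.column_bound {𝒜 : SpectralMatrixAlgebra I} {w : Weight I} (hw : Admissible 𝒜 w)
    {A : Ell2 I →L[ℂ] Ell2 I} (hA : A ∈ 𝒜.carrier) :
    ∃ C : ℝ, 0 ≤ C ∧ ∀ j, Summable (fun i => (w i : ℝ) * ‖entry A i j‖) ∧
      ∑' i, (w i : ℝ) * ‖entry A i j‖ ≤ C * w j := by
  classical
  obtain ⟨T, hT⟩ := hw A hA 1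
  refine ⟨‖T‖, norm_nonneg T, fun j => ?_⟩
  let x : lp (fun _ : I => ℂ) 1 := lp.single 1 j ((w j : ℝ) : ℂ)
  have hx : ‖x‖ = w j := by
    rw [lp.norm_single (by norm_num)]
    simp [abs_of_pos (w j).2]
  have hw0 : ∀ i, (((w i : ℝ) : ℂ)) ≠ 0 := fun i => by exact_mod_cast (w i).2.ne'
  have hTx : ∀ i, ‖(T x) i‖ = (w i : ℝ) * ‖entry A i j‖ := by
    intro i
    have h1 : HasSum (fun k => entry A i k * (x k / ((w k : ℝ) : ℂ))) (entry A i j) := by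
      convert hasSum_single j ?_ using 1
      · simp [x, hw0 j]
      · intro k hk
        simp [x, hk]
    have h2 := (hT x i).unique h1
    rw [div_eq_iff (hw0 i)] at h2
    rw [h2, norm_mul, mul_comm]
    simp [abs_of_pos (w i).2]
  have hs := lp.hasSum_norm (by norm_num : 0 < (1 : ℝ≥0∞).toReal) (T x)
  simp only [ENNReal.toReal_one, Real.rpow_one, hTx] at hs
  refine ⟨hs.summable, ?_⟩
  rw [hs.tsum_eq, ← hx]
  exact T.le_opNorm x

end Entry

section Frame

variable {ι H : Type*} [NormedAddCommGroup H] [InnerProductSpace ℂ H]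

/-- The analysis operator `f ↦ (⟨f, ψᵢ⟩)ᵢ` of a frame. -/
def IsFrame.analysis {ψ : ι → H} (hψ : IsFrame ψ) : H →L[ℂ] Ell2 ι :=
  LinearMap.mkContinuous
    { toFun := fun f => ⟨fun i => inner ℂ (ψ i) f, by
        obtain ⟨A, B, -, -, h⟩ := hψ
        exact (memℓp_gen_iff (by norm_num)).2 (by simpa using (h f).1)⟩
      map_add' := fun f g => by ext i; exact inner_add_right _ _ _
      map_smul' := fun c f => by ext i; exact inner_smul_right _ _ _ }
    (√ hψ.choose_spec.choose) (fun f => by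
      obtain ⟨-, hB, h⟩ := hψ.choose_spec.choose_spec
      refine (sq_le_sq₀ (norm_nonneg _) (by positivity)).1 ?_
      rw [mul_pow, Real.sq_sqrt hB.le]
      refine le_trans (le_of_eq ?_) (h f).2.2
      have := lp.norm_rpow_eq_tsum (by norm_num : 0 < (2 : ℝ≥0∞).toReal)
        (⟨fun i => inner ℂ (ψ i) f,
          (memℓp_gen_iff (by norm_num)).2 (by simpa using (h f).1)⟩ : Ell2 ι)
      simpa using this)

theorem IsFrame.analysis_apply {ψ : ι → H} (hψ : IsFrame ψ) (f : H) (i : ι) :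
    hψ.analysis f i = inner ℂ (ψ i) f := rfl

theorem IsFrame.exists_lower_bound {ψ : ι → H} (hψ : IsFrame ψ) :
    ∃ A : ℝ, 0 < A ∧ ∀ f, A * ‖f‖ ^ 2 ≤ ‖hψ.analysis f‖ ^ 2 := by
  obtain ⟨A, B, hA, -, h⟩ := id hψ
  refine ⟨A, hA, fun f => (h f).2.1.trans (le_of_eq ?_)⟩
  have := lp.norm_rpow_eq_tsum (by norm_num : 0 < (2 : ℝ≥0∞).toReal) (hψ.analysis f)
  simpa [hψ.analysis_apply] using this.symm

variable [CompleteSpace H]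

open ContinuousLinearMap (adjoint)

open Classical in
theorem IsFrame.adjoint_analysis_single {ψ : ι → H} (hψ : IsFrame ψ) (j : ι) (c : ℂ) :
    adjoint hψ.analysis (lp.single 2 j c) = c • ψ j := by
  refine ext_inner_right ℂ fun f => ?_
  rw [ContinuousLinearMap.adjoint_inner_left, lp.inner_single_left, hψ.analysis_apply,
    inner_smul_left]
  simp [mul_comm]

/-- The entries of `C L C*`, where `C` is the analysis operator. -/
theorem IsFrame.entry_conj {ψ : ι → H} (hψ : IsFrame ψ) (L : H →L[ℂ] H) (i j : ι) :
    entry (hψ.analysis ∘L L ∘L adjoint hψ.analysis) i j = inner ℂ (ψ i) (L (ψ j)) := by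
  classical
  have := hψ.adjoint_analysis_single j 1
  rw [one_smul] at this
  simp only [entry, ContinuousLinearMap.comp_apply, hψ.analysis_apply]
  convert! congrArg (fun v => inner ℂ (ψ i) (L v)) this

/-- The frame operator as a bounded operator. -/
def IsFrame.op {ψ : ι → H} (hψ : IsFrame ψ) : H →L[ℂ] H := adjoint hψ.analysis ∘L hψ.analysis

theorem IsFrame.hasSum_op {ψ : ι → H} (hψ : IsFrame ψ) (f : H) :
    HasSum (fun i => inner ℂ (ψ i) f • ψ i) (hψ.op f) := by
  classical
  have := (lp.hasSum_single (by norm_num : (2 : ℝ≥0∞) ≠ ⊤) (hψ.analysis f)).mapL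
    (adjoint hψ.analysis)
  simp only [hψ.adjoint_analysis_single, hψ.analysis_apply] at this
  exact this

theorem IsFrame.frameOp_eq {ψ : ι → H} (hψ : IsFrame ψ) : frameOp ψ = hψ.op :=
  funext fun f => (hψ.hasSum_op f).tsum_eq

theorem IsFrame.isUnit_op {ψ : ι → H} (hψ : IsFrame ψ) : IsUnit hψ.op := by
  obtain ⟨A, hA, h⟩ := hψ.exists_lower_bound
  refine ContinuousLinearMap.isUnit_of_forall_le_norm_inner_map _ (c := ⟨A, hA.le⟩) hA fun f => ?_
  rw [IsFrame.op, ContinuousLinearMap.comp_apply, ContinuousLinearMap.adjoint_inner_left,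
    inner_self_eq_norm_sq_to_K]
  refine (mul_comm _ _).trans_le ((h f).trans (le_of_eq ?_))
  simp

/-- The inverse of the frame operator. -/
def IsFrame.invOp {ψ : ι → H} (hψ : IsFrame ψ) : H →L[ℂ] H := Ring.inverse hψ.op

theorem IsFrame.op_mul_invOp {ψ : ι → H} (hψ : IsFrame ψ) : hψ.op * hψ.invOp = 1 :=
  Ring.mul_inverse_cancel _ hψ.isUnit_op

theorem IsFrame.invOp_mul_op {ψ : ι → H} (hψ : IsFrame ψ) : hψ.invOp * hψ.op = 1 :=
  Ring.inverse_mul_cancel _ hψ.isUnit_op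

theorem IsFrame.op_invOp {ψ : ι → H} (hψ : IsFrame ψ) (f : H) : hψ.op (hψ.invOp f) = f :=
  congrArg (fun T : H →L[ℂ] H => T f) hψ.op_mul_invOp

theorem IsFrame.invOp_op {ψ : ι → H} (hψ : IsFrame ψ) (f : H) : hψ.invOp (hψ.op f) = f :=
  congrArg (fun T : H →L[ℂ] H => T f) hψ.invOp_mul_op

theorem IsFrame.inner_invOp {ψ : ι → H} (hψ : IsFrame ψ) (f g : H) :
    inner ℂ (hψ.invOp f) g = inner ℂ f (hψ.invOp g) := by
  have hS : ∀ u v : H, inner ℂ (hψ.op u) v = inner ℂ u (hψ.op v) := fun u v => by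
    simp only [IsFrame.op, ContinuousLinearMap.comp_apply]
    rw [ContinuousLinearMap.adjoint_inner_left, ContinuousLinearMap.adjoint_inner_right]
  conv_lhs => rw [← hψ.op_invOp g]
  rw [← hS, hψ.op_invOp]

theorem IsFrame.canonicalDual_eq {ψ : ι → H} (hψ : IsFrame ψ) (i : ι) :
    canonicalDual ψ i = hψ.invOp (ψ i) := by
  have hinj : Function.Injective (frameOp ψ) := by
    rw [hψ.frameOp_eq]
    exact Function.LeftInverse.injective hψ.invOp_op
  have : ψ i = frameOp ψ (hψ.invOp (ψ i)) := by rw [hψ.frameOp_eq, hψ.op_invOp]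
  rw [canonicalDual]
  conv_lhs => rw [this]
  exact Function.leftInverse_invFun hinj _

theorem IsFrame.hasSum_frame {ψ : ι → H} (hψ : IsFrame ψ) (f : H) :
    HasSum (fun j => inner ℂ (canonicalDual ψ j) f • ψ j) f := by
  have := hψ.hasSum_op (hψ.invOp f)
  rw [hψ.op_invOp] at this
  refine this.congr_fun fun j => ?_
  rw [hψ.canonicalDual_eq, hψ.inner_invOp]

theorem IsFrame.hasSum_dual {ψ : ι → H} (hψ : IsFrame ψ) (f : H) :
    HasSum (fun j => inner ℂ (ψ j) f • canonicalDual ψ j) f := by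
  have := (hψ.hasSum_op f).mapL hψ.invOp
  rw [hψ.invOp_op] at this
  refine this.congr_fun fun j => ?_
  rw [hψ.canonicalDual_eq, map_smul]

/-- The Gram matrix `G` of a localised frame `ψ` belongs to the algebra, and with it its
pseudo-inverse, the Gram matrix of the canonical dual frame `ψ̃`, and the projection
`(⟨ψ_j, ψ̃_i⟩)` on the range of `G`. -/
theorem IsLocalisedFrame.gram_mem {𝒜 : SpectralMatrixAlgebra ι} {ψ : ι → H}
    (h : IsLocalisedFrame 𝒜 ψ) :
    (∃ A ∈ 𝒜.carrier, ∀ i j, entry A i j = inner ℂ (ψ i) (ψ j)) ∧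
    (∃ A ∈ 𝒜.carrier, ∀ i j, entry A i j = inner ℂ (canonicalDual ψ i) (ψ j)) ∧
    (∃ A ∈ 𝒜.carrier, ∀ i j, entry A i j = inner ℂ (canonicalDual ψ i) (canonicalDual ψ j)) := by
  obtain ⟨hψ, A, hA, hAe⟩ := h
  refine ⟨⟨A, hA, hAe⟩, ?_⟩
  set C := hψ.analysis with hC
  set T := hψ.invOp with hT
  have hST : (adjoint C ∘L C) ∘L T = 1 := hψ.op_mul_invOp
  have hTS : T ∘L (adjoint C ∘L C) = 1 := hψ.invOp_mul_op
  let Q : (H →L[ℂ] H) → (Ell2 ι →L[ℂ] Ell2 ι) := fun L => C ∘L L ∘L adjoint C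
  have hQ : ∀ L L' M : H →L[ℂ] H, L ∘L ((adjoint C ∘L C) ∘L L') = M → Q L * Q L' = Q M := by
    intro L L' M hM
    rw [← hM]
    rfl
  have hAQ : A = Q 1 := ext_entry fun i j => by
    rw [hAe]; exact (hψ.entry_conj 1 i j).symm
  rw [hAQ] at hA
  have h1 : ∀ L : H →L[ℂ] H, L ∘L 1 = L := fun L => rfl
  have h1' : ∀ L : H →L[ℂ] H, 1 ∘L L = L := fun L => rfl
  obtain ⟨hP, hE⟩ := 𝒜.pseudoInverse_mem (G := Q 1) (E := Q (T ∘L T)) (P := Q T) hA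
    (hQ _ _ _ (by rw [← ContinuousLinearMap.comp_assoc _ T T, hST, h1', h1']))
    (hQ _ _ _ (by rw [h1, ContinuousLinearMap.comp_assoc, hTS, h1]))
    (hQ _ _ _ (by rw [hST, h1]))
    (hQ _ _ _ (by rw [h1, hTS]))
    (hQ _ _ _ (by rw [← ContinuousLinearMap.comp_assoc _ T T, hST, h1']))
    (hQ _ _ _ (by rw [hST, h1]))
  refine ⟨⟨_, hP, fun i j => ?_⟩, ⟨_, hE, fun i j => ?_⟩⟩
  · rw [hψ.canonicalDual_eq, hψ.inner_invOp]
    exact hψ.entry_conj T i j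
  · rw [hψ.canonicalDual_eq, hψ.canonicalDual_eq, hψ.inner_invOp]
    exact hψ.entry_conj (T ∘L T) i j

end Frame

section Duality

variable {ι H : Type*} [NormedAddCommGroup H] [InnerProductSpace ℂ H]
  {ψ ψd : ι → H} {w : Weight ι}

/-! ### The coefficients of an element of `ℋ¹_w` -/

section CoorbitOne

theorem PreCoorbitOne.norm_def (f : PreCoorbitOne ψ ψd w) : ‖f‖ = ‖preAnalysisOne ψ ψd w f‖ := rfl

/-- `F ↦ w · C_{ψd} F ∈ ℓ¹`, the continuous extension of `preAnalysisOne`. -/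
def CoorbitOne.analysis (ψ ψd : ι → H) (w : Weight ι) :
    CoorbitOne ψ ψd w →L[ℂ] lp (fun _ : ι => ℂ) 1 :=
  ((preAnalysisOne ψ ψd w).mkContinuous 1 fun f => by
    rw [one_mul, PreCoorbitOne.norm_def]).extend UniformSpace.Completion.toComplL

theorem CoorbitOne.analysis_coe (f : PreCoorbitOne ψ ψd w) :
    CoorbitOne.analysis ψ ψd w f = preAnalysisOne ψ ψd w f :=
  ContinuousLinearMap.extend_eq _ UniformSpace.Completion.denseRange_coe
    (UniformSpace.Completion.isUniformInducing_coe _) f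

theorem CoorbitOne.norm_analysis (F : CoorbitOne ψ ψd w) :
    ‖CoorbitOne.analysis ψ ψd w F‖ = ‖F‖ := by
  induction F using UniformSpace.Completion.induction_on with
  | hp => exact isClosed_eq (by fun_prop) continuous_norm
  | ih f => rw [analysis_coe, UniformSpace.Completion.norm_coe, PreCoorbitOne.norm_def]

/-- A coefficient, as a continuous linear functional. -/
def CoorbitOne.coefL (ψ ψd : ι → H) (w : Weight ι) (i : ι) : CoorbitOne ψ ψd w →L[ℂ] ℂ :=
  ((w i : ℝ) : ℂ)⁻¹ • (lp.evalCLM ℂ (fun _ : ι => ℂ) 1 i ∘L CoorbitOne.analysis ψ ψd w)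

theorem CoorbitOne.coefL_coe (f : PreCoorbitOne ψ ψd w) (i : ι) :
    CoorbitOne.coefL ψ ψd w i f = inner ℂ (ψd i) f.val := by
  have hw : ((w i : ℝ) : ℂ) ≠ 0 := by exact_mod_cast (w i).2.ne'
  change ((w i : ℝ) : ℂ)⁻¹ * (CoorbitOne.analysis ψ ψd w f) i = _
  rw [analysis_coe]
  exact inv_mul_cancel_left₀ hw _

theorem CoorbitOne.coef_eq (F : CoorbitOne ψ ψd w) (i : ι) :
    F.coef i = CoorbitOne.coefL ψ ψd w i F := by
  have hfun : (fun f : PreCoorbitOne ψ ψd w => inner ℂ (ψd i) f.val) =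
      fun f : PreCoorbitOne ψ ψd w => CoorbitOne.coefL ψ ψd w i f :=
    funext fun f => (coefL_coe f i).symm
  rw [CoorbitOne.coef, hfun]
  exact congrFun (UniformSpace.Completion.extension_comp_coe
    (CoorbitOne.coefL ψ ψd w i).uniformContinuous) F

theorem CoorbitOne.coef_coe (f : PreCoorbitOne ψ ψd w) (i : ι) :
    CoorbitOne.coef (f : CoorbitOne ψ ψd w) i = inner ℂ (ψd i) f.val := by
  rw [coef_eq, coefL_coe]

theorem CoorbitOne.hasSum_norm_coef (F : CoorbitOne ψ ψd w) :
    HasSum (fun i => (w i : ℝ) * ‖F.coef i‖) ‖F‖ := by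
  have h := lp.hasSum_norm (by norm_num : 0 < (1 : ℝ≥0∞).toReal) (CoorbitOne.analysis ψ ψd w F)
  simp only [ENNReal.toReal_one, Real.rpow_one, norm_analysis] at h
  refine h.congr_fun fun i => ?_
  have hw := (w i).2
  rw [coef_eq]
  change _ * ‖((w i : ℝ) : ℂ)⁻¹ * (CoorbitOne.analysis ψ ψd w F) i‖ = _
  rw [norm_mul, norm_inv, Complex.norm_real, Real.norm_of_nonneg hw.le, mul_inv_cancel_left₀ hw.ne']

theorem CoorbitOne.ext_coef {F G : CoorbitOne ψ ψd w} (h : ∀ i, F.coef i = G.coef i) : F = G := by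
  have h0 : HasSum (fun _ : ι => (0 : ℝ)) ‖F - G‖ := by
    refine (F - G).hasSum_norm_coef.congr_fun fun i => ?_
    rw [CoorbitOne.coef_eq, map_sub, ← CoorbitOne.coef_eq, ← CoorbitOne.coef_eq, h, sub_self,
      norm_zero, mul_zero]
  exact sub_eq_zero.1 (norm_eq_zero.1 (h0.unique hasSum_zero))

end CoorbitOne

/-! ### Regular pairs of families -/

/-- The properties of a localised frame `ψ`, its canonical dual frame `ψd` and an admissible weight
`w` on which the duality of the co-orbit spaces rests. They pass to tensor products. A vector `f`
is only asked to be reconstructed, weakly, from its coefficients if these are in `ℓ^∞_{1/w}`; the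
series then converges absolutely. -/
structure IsRegular (ψ ψd : ι → H) (w : Weight ι) : Prop where
  hasSum_gram : ∀ (f : H) (M : ℝ), (∀ j, ‖inner ℂ (ψd j) f‖ ≤ M * w j) → ∀ i,
    HasSum (fun j => inner ℂ (ψ i) (ψ j) * inner ℂ (ψd j) f) (inner ℂ (ψ i) f)
  hasSum_cross : ∀ (f : H) (M : ℝ), (∀ j, ‖inner ℂ (ψd j) f‖ ≤ M * w j) → ∀ i,
    HasSum (fun j => inner ℂ (ψ i) (ψd j) * inner ℂ (ψ j) f) (inner ℂ (ψ i) f)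
  gram_bound : ∃ C : ℝ, 0 ≤ C ∧ ∀ i, Summable (fun j => (w j : ℝ) * ‖inner ℂ (ψ j) (ψ i)‖) ∧
    ∑' j, (w j : ℝ) * ‖inner ℂ (ψ j) (ψ i)‖ ≤ C * w i
  cross_bound : ∃ C : ℝ, 0 ≤ C ∧ ∀ i, Summable (fun j => (w j : ℝ) * ‖inner ℂ (ψd j) (ψ i)‖) ∧
    ∑' j, (w j : ℝ) * ‖inner ℂ (ψd j) (ψ i)‖ ≤ C * w i
  dual_bound : ∀ i, ∃ M : ℝ, ∀ j, ‖inner ℂ (ψd j) (ψd i)‖ ≤ M * w j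

theorem IsLocalisedFrame.isRegular [CompleteSpace H] {𝒜 : SpectralMatrixAlgebra ι}
    (hψ : IsLocalisedFrame 𝒜 ψ) (hw : Admissible 𝒜 w) : IsRegular ψ (canonicalDual ψ) w := by
  obtain ⟨⟨A, hA, hAe⟩, ⟨P, hP, hPe⟩, ⟨E, hE, hEe⟩⟩ := hψ.gram_mem
  refine ⟨fun f _ _ i => ?_, fun f _ _ i => ?_, ?_, ?_, fun i => ?_⟩
  · refine ((hψ.1.hasSum_frame f).mapL (innerSL ℂ (ψ i))).congr_fun fun j => ?_
    simp [mul_comm]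
  · refine ((hψ.1.hasSum_dual f).mapL (innerSL ℂ (ψ i))).congr_fun fun j => ?_
    simp [mul_comm]
  · simpa only [hAe] using hw.column_bound hA
  · simpa only [hPe] using hw.column_bound hP
  · -- `|⟨ψ̃_i, ψ̃_j⟩| w_i ≤ C w_j` comes from the `j`-th column.
    obtain ⟨C, -, hC⟩ := hw.column_bound hE
    simp only [hEe] at hC
    have hwi := (w i).2
    refine ⟨C / w i, fun j => ?_⟩
    have h1 := ((hC j).1.le_tsum i fun k _ => mul_nonneg (w k).2.le (norm_nonneg _)).trans (hC j).2
    rw [norm_inner_symm, div_mul_eq_mul_div, le_div_iff₀ hwi, mul_comm]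
    exact h1

/-- The coefficients of an element of `ℋ^∞_{1/w}`. -/
theorem CoorbitInf.norm_coef_le (G : CoorbitInf ψd w⁻¹) (j : ι) :
    ‖CoorbitInf.coef ψd w⁻¹ G j‖ ≤ ‖G‖ * w j := by
  have hw := (w j).2
  have h := lp.norm_apply_le_norm ENNReal.top_ne_zero (CoorbitInf.analysis ψd w⁻¹ G) j
  change ‖(((w⁻¹ j : {x : ℝ // 0 < x}) : ℝ) : ℂ) * CoorbitInf.coef ψd w⁻¹ G j‖ ≤ ‖G‖ at h
  rw [Pi.inv_apply, Positive.coe_inv, norm_mul, Complex.norm_real, Real.norm_of_nonneg (by positivity),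
    inv_mul_le_iff₀ hw, mul_comm] at h
  exact h

theorem infSeq_bound (F : infSeq ψd w⁻¹) : ∃ M : ℝ, ∀ n j, ‖inner ℂ (ψd j) (F.1 n)‖ ≤ M * w j := by
  obtain ⟨M, hM⟩ := F.2.2
  refine ⟨M, fun n j => ?_⟩
  have h := hM n j
  rwa [Pi.inv_apply, Positive.coe_inv, inv_mul_le_iff₀ (w j).2, mul_comm] at h

namespace IsRegular

variable (h : IsRegular ψ ψd w)

include h

/-- A norm bound for the Gram matrix as an operator on `ℓ^∞_{1/w}`. -/
theorem exists_gram_bound : ∃ C : ℝ, 0 ≤ C ∧ ∀ (c : ι → ℂ) (M : ℝ), (∀ j, ‖c j‖ ≤ M * w j) → ∀ i,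
    ‖∑' j, inner ℂ (ψ i) (ψ j) * c j‖ ≤ C * M * w i := by
  obtain ⟨C, hC0, hC⟩ := h.gram_bound
  refine ⟨C, hC0, fun c M hc i => ?_⟩
  have hM : 0 ≤ M := by
    have := (norm_nonneg _).trans (hc i)
    exact nonneg_of_mul_nonneg_left this (w i).2
  have hle : ∀ j, ‖inner ℂ (ψ i) (ψ j) * c j‖ ≤ M * ((w j : ℝ) * ‖inner ℂ (ψ j) (ψ i)‖) := by
    intro j
    rw [norm_mul, norm_inner_symm]
    calc _ ≤ ‖inner ℂ (ψ j) (ψ i)‖ * (M * w j) := by gcongr; exact hc j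
      _ = _ := by ring
  refine (tsum_of_norm_bounded ((hC i).1.hasSum.mul_left M) hle).trans ?_
  calc _ ≤ M * (C * w i) := by gcongr; exact (hC i).2
    _ = _ := by ring

/-- If the coefficients of `f` are in `ℓ^∞_{1/w}`, so are the numbers `⟨f, ψᵢ⟩`. -/
theorem exists_inner_bound : ∃ C : ℝ, 0 ≤ C ∧ ∀ (f : H) (M : ℝ),
    (∀ j, ‖inner ℂ (ψd j) f‖ ≤ M * w j) → ∀ i, ‖inner ℂ (ψ i) f‖ ≤ C * M * w i := by
  obtain ⟨C, hC0, hC⟩ := h.exists_gram_bound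
  refine ⟨C, hC0, fun f M hf i => ?_⟩
  rw [← (h.hasSum_gram f M hf i).tsum_eq]
  exact hC _ M hf i

/-- `lim_n ⟨F_n, ψᵢ⟩` exists and equals `∑ⱼ ⟨ψⱼ, ψᵢ⟩ (C_{ψd} F)_j`. -/
theorem tendsto_inner (F : infSeq ψd w⁻¹) (i : ι) :
    Tendsto (fun n => inner ℂ (ψ i) (F.1 n)) atTop
      (𝓝 (∑' j, inner ℂ (ψ i) (ψ j) * CoorbitInf.coef ψd w⁻¹ (CoorbitInf.mk F) j)) := by
  obtain ⟨C, -, hC⟩ := h.gram_bound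
  obtain ⟨M, hM⟩ := infSeq_bound F
  have key : Tendsto (fun n => ∑' j, inner ℂ (ψ i) (ψ j) * inner ℂ (ψd j) (F.1 n)) atTop
      (𝓝 (∑' j, inner ℂ (ψ i) (ψ j) * CoorbitInf.coef ψd w⁻¹ (CoorbitInf.mk F) j)) := by
    refine tendsto_tsum_of_dominated_convergence ((hC i).1.mul_left M) (fun j => ?_)
      (Eventually.of_forall fun n j => ?_)
    · exact (infSeq_tendsto F j).const_mul _
    · rw [norm_mul, norm_inner_symm]
      calc _ ≤ ‖inner ℂ (ψ j) (ψ i)‖ * (M * w j) := by gcongr; exact hM n j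
        _ = _ := by ring
  exact key.congr fun n => (h.hasSum_gram _ M (hM n) i).tsum_eq

theorem frameCoef_eq (G : CoorbitInf ψd w⁻¹) (i : ι) :
    G.frameCoef ψ i = ∑' j, inner ℂ (ψ i) (ψ j) * CoorbitInf.coef ψd w⁻¹ G j := by
  have := h.tendsto_inner G.rep i
  rw [CoorbitInf.mk_rep] at this
  exact this.limUnder_eq

/-- `(C_ψ F)_i` does not depend on the representing sequence. -/
theorem tendsto_frameCoef (F : infSeq ψd w⁻¹) (i : ι) :
    Tendsto (fun n => inner ℂ (ψ i) (F.1 n)) atTop (𝓝 ((CoorbitInf.mk F).frameCoef ψ i)) := by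
  rw [h.frameCoef_eq]
  exact h.tendsto_inner F i

theorem frameCoef_add (G G' : CoorbitInf ψd w⁻¹) (i : ι) :
    (G + G').frameCoef ψ i = G.frameCoef ψ i + G'.frameCoef ψ i := by
  have h1 := h.tendsto_frameCoef G.rep i
  have h2 := h.tendsto_frameCoef G'.rep i
  have h3 := h.tendsto_frameCoef (G.rep + G'.rep) i
  have hmk : CoorbitInf.mk (G.rep + G'.rep) = G + G' := by
    conv_rhs => rw [← G.mk_rep, ← G'.mk_rep]
    rfl
  rw [CoorbitInf.mk_rep] at h1 h2
  rw [hmk] at h3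
  refine tendsto_nhds_unique h3 ((h1.add h2).congr fun n => ?_)
  rw [← inner_add_right]
  rfl

theorem frameCoef_smul (c : ℂ) (G : CoorbitInf ψd w⁻¹) (i : ι) :
    (c • G).frameCoef ψ i = c * G.frameCoef ψ i := by
  have h1 := h.tendsto_frameCoef G.rep i
  have h3 := h.tendsto_frameCoef (c • G.rep) i
  have hmk : CoorbitInf.mk (c • G.rep) = c • G := by
    conv_rhs => rw [← G.mk_rep]
    rfl
  rw [CoorbitInf.mk_rep] at h1
  rw [hmk] at h3
  refine tendsto_nhds_unique h3 ((h1.const_mul c).congr fun n => ?_)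
  rw [← inner_smul_right]
  rfl

theorem exists_frameCoef_bound : ∃ C : ℝ, 0 ≤ C ∧ ∀ (G : CoorbitInf ψd w⁻¹) (i : ι),
    ‖G.frameCoef ψ i‖ ≤ C * ‖G‖ * w i := by
  obtain ⟨C, hC0, hC⟩ := h.exists_gram_bound
  refine ⟨C, hC0, fun G i => ?_⟩
  rw [h.frameCoef_eq]
  exact hC _ _ G.norm_coef_le i

/-! ### The duality of `ℋ¹_w` and `ℋ^∞_{1/w}` -/

/-- The series defining the duality converges absolutely. -/
theorem exists_pairing_bound : ∃ C : ℝ, 0 ≤ C ∧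
    ∀ (F : CoorbitOne ψ ψd w) (G : CoorbitInf ψd w⁻¹),
      Summable (fun i => F.coef i * conj (G.frameCoef ψ i)) ∧ ‖pairing F G‖ ≤ C * ‖F‖ * ‖G‖ := by
  obtain ⟨C, hC0, hC⟩ := h.exists_frameCoef_bound
  refine ⟨C, hC0, fun F G => ?_⟩
  have hle : ∀ i, ‖F.coef i * conj (G.frameCoef ψ i)‖ ≤ C * ‖G‖ * ((w i : ℝ) * ‖F.coef i‖) := by
    intro i
    rw [norm_mul, RCLike.norm_conj]
    calc _ ≤ ‖F.coef i‖ * (C * ‖G‖ * w i) := by gcongr; exact hC G i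
      _ = _ := by ring
  have hs := F.hasSum_norm_coef.mul_left (C * ‖G‖)
  refine ⟨Summable.of_norm_bounded hs.summable hle, ?_⟩
  refine (tsum_of_norm_bounded hs hle).trans (le_of_eq ?_)
  ring

theorem hasSum_pairing (F : CoorbitOne ψ ψd w) (G : CoorbitInf ψd w⁻¹) :
    HasSum (fun i => F.coef i * conj (G.frameCoef ψ i)) (pairing F G) :=
  let ⟨_, _, hC⟩ := h.exists_pairing_bound
  (hC F G).1.hasSum

end IsRegular

/-- `F ↦ ⟨F, G⟩` as a continuous linear functional on `ℋ¹_w`. -/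
def IsRegular.pairingL (h : IsRegular ψ ψd w) (G : CoorbitInf ψd w⁻¹) : CoorbitOne ψ ψd w →L[ℂ] ℂ :=
  LinearMap.mkContinuous
    { toFun := fun F => pairing F G
      map_add' := fun F F' => by
        refine (h.hasSum_pairing (F + F') G).unique
          (((h.hasSum_pairing F G).add (h.hasSum_pairing F' G)).congr_fun fun i => ?_)
        rw [CoorbitOne.coef_eq, CoorbitOne.coef_eq, CoorbitOne.coef_eq, map_add, add_mul]
      map_smul' := fun c F => by
        refine (h.hasSum_pairing (c • F) G).unique
          (((h.hasSum_pairing F G).const_smul c).congr_fun fun i => ?_)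
        rw [CoorbitOne.coef_eq, CoorbitOne.coef_eq, map_smul, smul_mul_assoc] }
    (h.exists_pairing_bound.choose * ‖G‖) fun F => by
      refine (h.exists_pairing_bound.choose_spec.2 F G).2.trans (le_of_eq ?_)
      ring

theorem IsRegular.pairingL_apply (h : IsRegular ψ ψd w) (G : CoorbitInf ψd w⁻¹)
    (F : CoorbitOne ψ ψd w) : h.pairingL G F = pairing F G := rfl

/-- `G ↦ ⟨G, F⟩` as a continuous linear functional on `ℋ^∞_{1/w}`. -/
def IsRegular.pairingL' (h : IsRegular ψ ψd w) (F : CoorbitOne ψ ψd w) : CoorbitInf ψd w⁻¹ →L[ℂ] ℂ :=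
  LinearMap.mkContinuous
    { toFun := fun G => pairing' G F
      map_add' := fun G G' => by
        rw [pairing', pairing', pairing', ← map_add]
        congr 1
        refine (h.hasSum_pairing F (G + G')).unique
          (((h.hasSum_pairing F G).add (h.hasSum_pairing F G')).congr_fun fun i => ?_)
        rw [h.frameCoef_add, map_add, mul_add]
      map_smul' := fun c G => by
        rw [pairing', pairing', RingHom.id_apply, smul_eq_mul, ← Complex.conj_conj c, ← map_mul,
          Complex.conj_conj]
        congr 1
        refine (h.hasSum_pairing F (c • G)).unique
          (((h.hasSum_pairing F G).const_smul (conj c)).congr_fun fun i => ?_)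
        rw [h.frameCoef_smul, map_mul, smul_eq_mul, mul_left_comm] }
    (h.exists_pairing_bound.choose * ‖F‖) fun G => by
      change ‖conj (pairing F G)‖ ≤ _
      rw [RCLike.norm_conj]
      exact (h.exists_pairing_bound.choose_spec.2 F G).2

theorem IsRegular.exists_norm_pairingL'_le (h : IsRegular ψ ψd w) :
    ∃ C : ℝ, 0 ≤ C ∧ ∀ F : CoorbitOne ψ ψd w, ‖h.pairingL' F‖ ≤ C * ‖F‖ :=
  ⟨_, h.exists_pairing_bound.choose_spec.1, fun _ => LinearMap.mkContinuous_norm_le _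
    (mul_nonneg h.exists_pairing_bound.choose_spec.1 (norm_nonneg _)) _⟩

/-- The frame vector `ψ_k` as an element of `ℋ¹_w`. -/
def IsRegular.atom (h : IsRegular ψ ψd w) (k : ι) : CoorbitOne ψ ψd w :=
  UniformSpace.Completion.coe' (show PreCoorbitOne ψ ψd w from
    ⟨ψ k, Submodule.subset_span ⟨k, rfl⟩, by
      obtain ⟨C, -, hC⟩ := h.cross_bound
      refine (memℓp_gen_iff (by norm_num)).2 ((hC k).1.congr fun i => ?_)
      simp [abs_of_pos (w i).2]⟩)

theorem IsRegular.coef_atom (h : IsRegular ψ ψd w) (k i : ι) :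
    (h.atom k).coef i = inner ℂ (ψd i) (ψ k) :=
  CoorbitOne.coef_coe _ i

theorem IsRegular.exists_norm_atom_le (h : IsRegular ψ ψd w) :
    ∃ C : ℝ, 0 ≤ C ∧ ∀ k, ‖h.atom k‖ ≤ C * w k := by
  obtain ⟨C, hC0, hC⟩ := h.cross_bound
  refine ⟨C, hC0, fun k => ?_⟩
  rw [← (h.atom k).hasSum_norm_coef.tsum_eq]
  simp only [h.coef_atom]
  exact (hC k).2

/-- `⟨ψ_k, G⟩ = conj (C_ψ G)_k`. -/
theorem IsRegular.pairing_atom (h : IsRegular ψ ψd w) (k : ι) (G : CoorbitInf ψd w⁻¹) :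
    pairing (h.atom k) G = conj (G.frameCoef ψ k) := by
  obtain ⟨C, hC0, hC⟩ := h.exists_inner_bound
  obtain ⟨C', -, hC'⟩ := h.cross_bound
  obtain ⟨M, hM⟩ := infSeq_bound G.rep
  have hG : ∀ i, Tendsto (fun n => inner ℂ (ψ i) (G.rep.1 n)) atTop (𝓝 (G.frameCoef ψ i)) := by
    intro i
    simpa only [CoorbitInf.mk_rep] using h.tendsto_frameCoef G.rep i
  have key : Tendsto (fun n => ∑' j, inner ℂ (ψ k) (ψd j) * inner ℂ (ψ j) (G.rep.1 n)) atTop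
      (𝓝 (∑' j, inner ℂ (ψ k) (ψd j) * G.frameCoef ψ j)) := by
    refine tendsto_tsum_of_dominated_convergence ((hC' k).1.mul_left (C * M)) (fun j => ?_)
      (Eventually.of_forall fun n j => ?_)
    · exact (hG j).const_mul _
    · rw [norm_mul, norm_inner_symm]
      calc _ ≤ ‖inner ℂ (ψd j) (ψ k)‖ * (C * M * w j) := by gcongr; exact hC _ M (hM n) j
        _ = _ := by ring
  have key' := tendsto_nhds_unique (hG k)
    (key.congr fun n => (h.hasSum_cross _ M (hM n) k).tsum_eq)
  rw [key', pairing, Complex.conj_tsum]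
  refine tsum_congr fun j => ?_
  rw [h.coef_atom, map_mul, inner_conj_symm]

/-- The vector `ψd_k`, as an element of `ℋ^∞_{1/w}`. -/
def IsRegular.dualAtom (h : IsRegular ψ ψd w) (k : ι) : CoorbitInf ψd w⁻¹ :=
  CoorbitInf.mk ⟨fun _ => ψd k, fun _ => ⟨_, tendsto_const_nhds⟩, by
    obtain ⟨M, hM⟩ := h.dual_bound k
    refine ⟨M, fun _ j => ?_⟩
    rw [Pi.inv_apply, Positive.coe_inv, inv_mul_le_iff₀ (w j).2, mul_comm]
    exact hM j⟩

theorem IsRegular.frameCoef_dualAtom (h : IsRegular ψ ψd w) (k i : ι) :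
    (h.dualAtom k).frameCoef ψ i = inner ℂ (ψ i) (ψd k) :=
  tendsto_nhds_unique (h.tendsto_frameCoef _ i) tendsto_const_nhds

/-- The elements `ψd_k` of `ℋ^∞_{1/w}` recover the coefficients of an element of `ℋ¹_w`. -/
theorem IsRegular.pairing_dualAtom (h : IsRegular ψ ψd w) (F : CoorbitOne ψ ψd w) (k : ι) :
    pairing F (h.dualAtom k) = F.coef k := by
  rw [CoorbitOne.coef_eq, ← h.pairingL_apply]
  induction F using UniformSpace.Completion.induction_on with
  | hp => exact isClosed_eq (h.pairingL _).continuous (CoorbitOne.coefL ψ ψd w k).continuous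
  | ih f =>
    rw [CoorbitOne.coefL_coe, h.pairingL_apply, pairing]
    simp only [CoorbitOne.coef_coe, h.frameCoef_dualAtom, inner_conj_symm]
    refine HasSum.tsum_eq ?_
    obtain ⟨M, hM⟩ := h.dual_bound k
    have hf : f.val ∈ Submodule.span ℂ (Set.range ψ) := f.2.1
    generalize f.val = x at hf ⊢
    induction hf using Submodule.span_induction with
    | mem x hx =>
      obtain ⟨m, rfl⟩ := hx
      have := Complex.hasSum_conj'.2 (h.hasSum_cross (ψd k) M hM m)
      simpa only [map_mul, inner_conj_symm, mul_comm] using this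
    | zero => simpa only [inner_zero_right, zero_mul] using hasSum_zero
    | add x y _ _ hx hy => simpa only [inner_add_right, add_mul] using hx.add hy
    | smul c x _ hx => simpa only [inner_smul_right, mul_assoc] using hx.mul_left c

/-- An element of `ℋ¹_w` is determined by its pairings with the vectors `ψd_k`. -/
theorem IsRegular.ext_pairing (h : IsRegular ψ ψd w) {F F' : CoorbitOne ψ ψd w}
    (hF : ∀ k, pairing F (h.dualAtom k) = pairing F' (h.dualAtom k)) : F = F' :=
  CoorbitOne.ext_coef fun k => by rw [← h.pairing_dualAtom, ← h.pairing_dualAtom, hF]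

/-- Synthesis `c ↦ ∑ᵢ cᵢ ψᵢ` is bounded from `ℓ¹_w` to `ℋ¹_w`. -/
theorem IsRegular.exists_synthesis (h : IsRegular ψ ψd w) : ∃ C : ℝ, 0 ≤ C ∧
    ∀ (c : ι → ℂ) (s : ℝ), HasSum (fun i => (w i : ℝ) * ‖c i‖) s →
      ∃ F : CoorbitOne ψ ψd w, ‖F‖ ≤ C * s ∧
        ∀ G, HasSum (fun i => c i * conj (G.frameCoef ψ i)) (pairing F G) := by
  obtain ⟨C, hC0, hC⟩ := h.exists_norm_atom_le
  refine ⟨C, hC0, fun c s hs => ?_⟩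
  have hle : ∀ i, ‖c i • h.atom i‖ ≤ C * ((w i : ℝ) * ‖c i‖) := by
    intro i
    rw [norm_smul]
    calc _ ≤ ‖c i‖ * (C * w i) := by gcongr; exact hC i
      _ = _ := by ring
  have hsum : Summable fun i => c i • h.atom i :=
    Summable.of_norm_bounded (hs.mul_left C).summable hle
  refine ⟨∑' i, c i • h.atom i, tsum_of_norm_bounded (hs.mul_left C) hle, fun G => ?_⟩
  refine (hsum.hasSum.mapL (h.pairingL G)).congr_fun fun i => ?_
  rw [map_smul, h.pairingL_apply, h.pairing_atom, smul_eq_mul]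

end Duality

/-! ### Tensor products of regular pairs -/

theorem hasSum_mul_prod {α β : Type*} {a : α → ℝ} {b : β → ℝ} {s t : ℝ} (ha : HasSum a s)
    (hb : HasSum b t) (ha0 : ∀ i, 0 ≤ a i) (hb0 : ∀ j, 0 ≤ b j) :
    HasSum (fun p : α × β => a p.1 * b p.2) (s * t) :=
  ha.mul hb (ha.summable.mul_of_nonneg hb.summable ha0 hb0)

theorem tensorWeight_apply {I J : Type*} (w₁ : Weight I) (w₂ : Weight J) (p : I × J) :
    (tensorWeight w₁ w₂ p : ℝ) = w₁ p.1 * w₂ p.2 := rfl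

section Tensor

variable {I J H₁ H₂ : Type*} [NormedAddCommGroup H₁] [InnerProductSpace ℂ H₁] [CompleteSpace H₁]
  [NormedAddCommGroup H₂] [InnerProductSpace ℂ H₂]

theorem norm_inner_simpleTensor_simpleTensor (f₁ g₁ : H₁) (f₂ g₂ : H₂) :
    ‖inner ℂ (simpleTensor f₁ f₂) (simpleTensor g₁ g₂)‖ = ‖inner ℂ f₁ g₁‖ * ‖inner ℂ f₂ g₂‖ := by
  rw [inner_simpleTensor_simpleTensor, norm_mul, RCLike.norm_conj]

/-- Weak reconstruction in both factors gives weak reconstruction in the tensor product, provided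
that the double series converges absolutely: it may then be summed over the second index first. -/
theorem hasSum_simpleTensor [CompleteSpace H₂] {α₁ β₁ : I → H₁} {α₂ β₂ : J → H₂} {θ₁ : H₁}
    {θ₂ : H₂} (O : HTensor H₁ H₂)
    (hs : Summable fun p : I × J =>
      inner ℂ (simpleTensor θ₁ θ₂) (simpleTensor (α₁ p.1) (α₂ p.2)) *
        inner ℂ (simpleTensor (β₁ p.1) (β₂ p.2)) O)
    (h₁ : HasSum (fun i => inner ℂ θ₁ (α₁ i) *
      inner ℂ (β₁ i) (ContinuousLinearMap.adjoint O.op θ₂))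
        (inner ℂ θ₁ (ContinuousLinearMap.adjoint O.op θ₂)))
    (h₂ : ∀ i, HasSum (fun j => inner ℂ θ₂ (α₂ j) * inner ℂ (β₂ j) (O.op (β₁ i)))
      (inner ℂ θ₂ (O.op (β₁ i)))) :
    HasSum (fun p : I × J => inner ℂ (simpleTensor θ₁ θ₂) (simpleTensor (α₁ p.1) (α₂ p.2)) *
      inner ℂ (simpleTensor (β₁ p.1) (β₂ p.2)) O) (inner ℂ (simpleTensor θ₁ θ₂) O) := by
  have hadj : ∀ x, conj (inner ℂ x (ContinuousLinearMap.adjoint O.op θ₂)) =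
      inner ℂ θ₂ (O.op x) := fun x => by
    rw [inner_conj_symm, ContinuousLinearMap.adjoint_inner_left]
  have hfib := hs.hasSum.prod_fiberwise (g := fun i =>
    conj (inner ℂ θ₁ (α₁ i)) * inner ℂ θ₂ (O.op (β₁ i))) fun i => by
      refine ((h₂ i).mul_left (conj (inner ℂ θ₁ (α₁ i)))).congr_fun fun j => ?_
      rw [inner_simpleTensor_simpleTensor, inner_simpleTensor, mul_assoc]
  have hconj := Complex.hasSum_conj'.2 h₁
  simp only [map_mul, hadj] at hconj
  have := hs.hasSum
  rwa [hfib.unique hconj, ← inner_simpleTensor] at this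

/-- Schur type bounds multiply. -/
theorem tensor_bound {α₁ β₁ : I → H₁} {α₂ β₂ : J → H₂} {w₁ : Weight I} {w₂ : Weight J}
    (h₁ : ∃ C : ℝ, 0 ≤ C ∧ ∀ i, Summable (fun j => (w₁ j : ℝ) * ‖inner ℂ (α₁ j) (β₁ i)‖) ∧
      ∑' j, (w₁ j : ℝ) * ‖inner ℂ (α₁ j) (β₁ i)‖ ≤ C * w₁ i)
    (h₂ : ∃ C : ℝ, 0 ≤ C ∧ ∀ i, Summable (fun j => (w₂ j : ℝ) * ‖inner ℂ (α₂ j) (β₂ i)‖) ∧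
      ∑' j, (w₂ j : ℝ) * ‖inner ℂ (α₂ j) (β₂ i)‖ ≤ C * w₂ i) :
    ∃ C : ℝ, 0 ≤ C ∧ ∀ p, Summable (fun q => (tensorWeight w₁ w₂ q : ℝ) *
        ‖inner ℂ (tensorFamily α₁ α₂ q) (tensorFamily β₁ β₂ p)‖) ∧
      ∑' q, (tensorWeight w₁ w₂ q : ℝ) *
        ‖inner ℂ (tensorFamily α₁ α₂ q) (tensorFamily β₁ β₂ p)‖ ≤ C * tensorWeight w₁ w₂ p := by
  obtain ⟨C, hC0, hC⟩ := h₁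
  obtain ⟨D, hD0, hD⟩ := h₂
  refine ⟨C * D, mul_nonneg hC0 hD0, fun p => ?_⟩
  have hsum : HasSum (fun q => (tensorWeight w₁ w₂ q : ℝ) *
      ‖inner ℂ (tensorFamily α₁ α₂ q) (tensorFamily β₁ β₂ p)‖)
      ((∑' i, (w₁ i : ℝ) * ‖inner ℂ (α₁ i) (β₁ p.1)‖) *
        ∑' j, (w₂ j : ℝ) * ‖inner ℂ (α₂ j) (β₂ p.2)‖) := by
    refine (hasSum_mul_prod (hC p.1).1.hasSum (hD p.2).1.hasSum
      (fun i => mul_nonneg (w₁ i).2.le (norm_nonneg _))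
      (fun j => mul_nonneg (w₂ j).2.le (norm_nonneg _))).congr_fun fun q => ?_
    rw [tensorWeight_apply, tensorFamily, tensorFamily, norm_inner_simpleTensor_simpleTensor]
    ring
  refine ⟨hsum.summable, ?_⟩
  rw [hsum.tsum_eq, tensorWeight_apply]
  calc _ ≤ (C * w₁ p.1) * (D * w₂ p.2) :=
        mul_le_mul (hC p.1).2 (hD p.2).2
          (tsum_nonneg fun j => mul_nonneg (w₂ j).2.le (norm_nonneg _))
          (mul_nonneg hC0 (w₁ p.1).2.le)
    _ = _ := by ring

theorem summable_of_tensor_bound {α₁ : I → H₁} {α₂ : J → H₂} {w₁ : Weight I} {w₂ : Weight J}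
    {θ : HTensor H₁ H₂} {c : I × J → ℂ} {M : ℝ}
    (hs : Summable fun q => (tensorWeight w₁ w₂ q : ℝ) * ‖inner ℂ (tensorFamily α₁ α₂ q) θ‖)
    (hc : ∀ q : I × J, ‖c q‖ ≤ M * (w₁ q.1 * w₂ q.2)) :
    Summable fun q => inner ℂ θ (tensorFamily α₁ α₂ q) * c q := by
  refine Summable.of_norm_bounded (hs.mul_left M) fun q => ?_
  rw [norm_mul, norm_inner_symm, tensorWeight_apply]
  calc _ ≤ ‖inner ℂ (tensorFamily α₁ α₂ q) θ‖ * (M * (w₁ q.1 * w₂ q.2)) := by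
        gcongr; exact hc q
    _ = _ := by ring

/-- The tensor product of two regular pairs is regular. -/
theorem IsRegular.tensor [CompleteSpace H₂] {ψ₁ φ₁ : I → H₁} {ψ₂ φ₂ : J → H₂} {w₁ : Weight I}
    {w₂ : Weight J} (h₁ : IsRegular ψ₁ φ₁ w₁) (h₂ : IsRegular ψ₂ φ₂ w₂) :
    IsRegular (tensorFamily ψ₁ ψ₂) (tensorFamily φ₁ φ₂) (tensorWeight w₁ w₂) := by
  have hgram := tensor_bound h₁.gram_bound h₂.gram_bound
  have hcross := tensor_bound h₁.cross_bound h₂.cross_bound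
  obtain ⟨C₁, hC₁, hb₁⟩ := h₁.exists_inner_bound
  obtain ⟨C₂, hC₂, hb₂⟩ := h₂.exists_inner_bound
  have hcoef : ∀ (O : HTensor H₁ H₂) (M : ℝ),
      (∀ q, ‖inner ℂ (tensorFamily φ₁ φ₂ q) O‖ ≤ M * tensorWeight w₁ w₂ q) → ∀ i j,
      ‖inner ℂ (φ₂ j) (O.op (φ₁ i))‖ ≤ M * (w₁ i * w₂ j) := fun O M hO i j => by
    rw [← inner_simpleTensor]
    exact hO (i, j)
  -- The operator and its adjoint map the families to vectors with coefficients in `ℓ^∞_{1/w}`.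
  have hadj : ∀ (O : HTensor H₁ H₂) (x : H₁) (y : H₂),
      ‖inner ℂ x (ContinuousLinearMap.adjoint O.op y)‖ = ‖inner ℂ y (O.op x)‖ := fun O x y => by
    rw [ContinuousLinearMap.adjoint_inner_right, norm_inner_symm]
  have hop : ∀ (O : HTensor H₁ H₂) (M : ℝ),
      (∀ q, ‖inner ℂ (tensorFamily φ₁ φ₂ q) O‖ ≤ M * tensorWeight w₁ w₂ q) →
      (∀ i j, ‖inner ℂ (ψ₂ j) (O.op (φ₁ i))‖ ≤ C₂ * M * w₂ j * w₁ i) ∧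
      (∀ i j, ‖inner ℂ (φ₂ j) (O.op (ψ₁ i))‖ ≤ C₁ * M * w₁ i * w₂ j) := by
    intro O M hO
    refine ⟨fun i j => ?_, fun i j => ?_⟩
    · refine (hb₂ _ (M * w₁ i) (fun k => ?_) j).trans (le_of_eq (by ring))
      exact (hcoef O M hO i k).trans (le_of_eq (by ring))
    · rw [← hadj]
      refine (hb₁ _ (M * w₂ j) (fun k => ?_) i).trans (le_of_eq (by ring))
      rw [hadj]
      exact (hcoef O M hO k j).trans (le_of_eq (by ring))
  refine ⟨fun O M hO p => ?_, fun O M hO p => ?_, hgram, hcross, fun p => ?_⟩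
  · obtain ⟨C, -, hC⟩ := hgram
    refine hasSum_simpleTensor O (summable_of_tensor_bound (hC p).1 hO) ?_ fun i => ?_
    · refine h₁.hasSum_gram _ (C₂ * M * w₂ p.2) (fun i => ?_) p.1
      rw [hadj]
      exact (hop O M hO).1 i p.2
    · exact h₂.hasSum_gram _ (M * w₁ i)
        (fun j => (hcoef O M hO i j).trans (le_of_eq (by ring))) p.2
  · obtain ⟨C, -, hC⟩ := hcross
    refine hasSum_simpleTensor O
      (summable_of_tensor_bound (M := C₂ * (C₁ * M)) (hC p).1 fun q => ?_) ?_ fun i => ?_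
    · rw [inner_simpleTensor]
      refine (hb₂ _ _ (fun j => (hop O M hO).2 q.1 j) q.2).trans (le_of_eq (by ring))
    · refine h₁.hasSum_cross _ (C₂ * M * w₂ p.2) (fun i => ?_) p.1
      rw [hadj]
      exact (hop O M hO).1 i p.2
    · exact h₂.hasSum_cross _ _ (fun j => (hop O M hO).2 i j) p.2
  · obtain ⟨M, hM⟩ := h₁.dual_bound p.1
    obtain ⟨N, hN⟩ := h₂.dual_bound p.2
    refine ⟨M * N, fun q => ?_⟩
    rw [tensorFamily, tensorFamily, norm_inner_simpleTensor_simpleTensor, tensorWeight_apply]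
    calc _ ≤ (M * w₁ q.1) * (N * w₂ q.2) :=
          mul_le_mul (hM q.1) (hN q.2) (norm_nonneg _) ((norm_nonneg _).trans (hM q.1))
      _ = _ := by ring

theorem frameCoef_infTensor [CompleteSpace H₂] {ψ₁ φ₁ : I → H₁} {ψ₂ φ₂ : J → H₂}
    {w₁ : Weight I} {w₂ : Weight J} (h₁ : IsRegular ψ₁ φ₁ w₁) (h₂ : IsRegular ψ₂ φ₂ w₂)
    (f₁ : CoorbitInf φ₁ w₁⁻¹) (f₂ : CoorbitInf φ₂ w₂⁻¹) (p : I × J) :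
    (infTensor f₁ f₂).frameCoef (tensorFamily ψ₁ ψ₂) p =
      conj (f₁.frameCoef ψ₁ p.1) * f₂.frameCoef ψ₂ p.2 := by
  have e₁ := h₁.tendsto_frameCoef f₁.rep p.1
  have e₂ := h₂.tendsto_frameCoef f₂.rep p.2
  rw [CoorbitInf.mk_rep] at e₁ e₂
  refine tendsto_nhds_unique
    ((h₁.tensor h₂).tendsto_frameCoef ⟨_, infSeq_tensor f₁.rep f₂.rep⟩ p) ?_
  simp only [tensorFamily, inner_simpleTensor_simpleTensor]
  exact ((Complex.continuous_conj.tendsto _).comp e₁).mul e₂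

theorem infTensor_dualAtom [CompleteSpace H₂] {ψ₁ φ₁ : I → H₁} {ψ₂ φ₂ : J → H₂}
    {w₁ : Weight I} {w₂ : Weight J} (h₁ : IsRegular ψ₁ φ₁ w₁) (h₂ : IsRegular ψ₂ φ₂ w₂)
    (p : I × J) :
    infTensor (h₁.dualAtom p.1) (h₂.dualAtom p.2) = (h₁.tensor h₂).dualAtom p :=
  infTensor_mk _ _

end Tensor

/-! ### Kernels and operators -/

section Kernel

variable {I J H₁ H₂ : Type*} [NormedAddCommGroup H₁] [InnerProductSpace ℂ H₁] [CompleteSpace H₁]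
  [NormedAddCommGroup H₂] [InnerProductSpace ℂ H₂]
  {ψ₁ : I → H₁} {ψ₂ : J → H₂} {w₁ : Weight I} {w₂ : Weight J}

/-- `K` is a kernel of `O`: `⟨K, f₁ ⊗ f₂⟩ = ⟨O f₁, f₂⟩` for all `f₁ ∈ ℋ^∞_{1/w₁}(ψ₁)` and
`f₂ ∈ ℋ^∞_{1/w₂}(ψ₂)`. -/
def IsKernel (K : HOneTensor ψ₁ ψ₂ w₁ w₂) (O : HInf ψ₁ w₁⁻¹ →L[ℂ] HOne ψ₂ w₂) : Prop :=
  ∀ (f₁ : HInf ψ₁ w₁⁻¹) (f₂ : HInf ψ₂ w₂⁻¹), pairing K (infTensor f₁ f₂) = pairing (O f₁) f₂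

theorem IsKernel.operator_unique (h₂ : IsRegular ψ₂ (canonicalDual ψ₂) w₂)
    {K : HOneTensor ψ₁ ψ₂ w₁ w₂} {O O' : HInf ψ₁ w₁⁻¹ →L[ℂ] HOne ψ₂ w₂}
    (h : IsKernel K O) (h' : IsKernel K O') : O = O' := by
  refine ContinuousLinearMap.ext fun f₁ => h₂.ext_pairing fun k => ?_
  rw [← h, ← h']

theorem IsKernel.kernel_unique [CompleteSpace H₂] (h₁ : IsRegular ψ₁ (canonicalDual ψ₁) w₁)
    (h₂ : IsRegular ψ₂ (canonicalDual ψ₂) w₂)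
    {K K' : HOneTensor ψ₁ ψ₂ w₁ w₂} {O : HInf ψ₁ w₁⁻¹ →L[ℂ] HOne ψ₂ w₂}
    (h : IsKernel K O) (h' : IsKernel K' O) : K = K' := by
  refine (h₁.tensor h₂).ext_pairing fun p => ?_
  rw [← infTensor_dualAtom h₁ h₂, h, h']

theorem IsKernel.add [CompleteSpace H₂] (h₁ : IsRegular ψ₁ (canonicalDual ψ₁) w₁)
    (h₂ : IsRegular ψ₂ (canonicalDual ψ₂) w₂)
    {K K' : HOneTensor ψ₁ ψ₂ w₁ w₂} {O O' : HInf ψ₁ w₁⁻¹ →L[ℂ] HOne ψ₂ w₂}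
    (h : IsKernel K O) (h' : IsKernel K' O') : IsKernel (K + K') (O + O') := by
  intro f₁ f₂
  rw [← (h₁.tensor h₂).pairingL_apply, map_add, add_apply,
    ← h₂.pairingL_apply, map_add]
  exact congrArg₂ _ (h f₁ f₂) (h' f₁ f₂)

theorem IsKernel.smul [CompleteSpace H₂] (h₁ : IsRegular ψ₁ (canonicalDual ψ₁) w₁)
    (h₂ : IsRegular ψ₂ (canonicalDual ψ₂) w₂) (c : ℂ)
    {K : HOneTensor ψ₁ ψ₂ w₁ w₂} {O : HInf ψ₁ w₁⁻¹ →L[ℂ] HOne ψ₂ w₂}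
    (h : IsKernel K O) : IsKernel (c • K) (c • O) := by
  intro f₁ f₂
  rw [← (h₁.tensor h₂).pairingL_apply, map_smul, smul_apply,
    ← h₂.pairingL_apply, map_smul]
  exact congrArg _ (h f₁ f₂)

omit [CompleteSpace H₁] in
theorem kernelOperatorNorm_le {f : ℕ → HOne ψ₁ w₁} {g : ℕ → HOne ψ₂ w₂}
    {O : HInf ψ₁ w₁⁻¹ →L[ℂ] HOne ψ₂ w₂} (hO : Represents f g O) :
    kernelOperatorNorm O ≤ ∑' r, ‖f r‖ * ‖g r‖ := by
  refine csInf_le ⟨0, ?_⟩ ⟨f, g, hO, rfl⟩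
  rintro s ⟨f', g', -, rfl⟩
  exact tsum_nonneg fun r => by positivity

omit [CompleteSpace H₁] in
/-- An absolutely convergent series of rank one operators over a countable index set defines a
member of `𝓑`; the index set is embedded in `ℕ`, and the series is extended by zero. -/
theorem exists_represents (h₁ : IsRegular ψ₁ (canonicalDual ψ₁) w₁) {α : Type*} [Countable α]
    (F : α → HOne ψ₁ w₁) (G : α → HOne ψ₂ w₂) (hs : Summable fun p => ‖F p‖ * ‖G p‖) :
    ∃ (O : HInf ψ₁ w₁⁻¹ →L[ℂ] HOne ψ₂ w₂) (f : ℕ → HOne ψ₁ w₁) (g : ℕ → HOne ψ₂ w₂),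
      Represents f g O ∧ ∑' r, ‖f r‖ * ‖g r‖ = ∑' p, ‖F p‖ * ‖G p‖ ∧
        ∀ h, HasSum (fun p => pairing' h (F p) • G p) (O h) := by
  obtain ⟨C, hC0, hC⟩ := h₁.exists_norm_pairingL'_le
  have hsum : Summable fun p => (h₁.pairingL' (F p)).smulRight (G p) := by
    refine Summable.of_norm_bounded (hs.mul_left C) fun p => ?_
    rw [ContinuousLinearMap.norm_smulRight_apply, ← mul_assoc]
    gcongr
    exact hC _
  have hO : ∀ h, HasSum (fun p => pairing' h (F p) • G p)
      ((∑' p, (h₁.pairingL' (F p)).smulRight (G p)) h) := fun h =>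
    hsum.hasSum.mapL (ContinuousLinearMap.apply ℂ _ h)
  obtain ⟨e, he⟩ := exists_injective_nat α
  have hnorm : (fun r => ‖Function.extend e F 0 r‖ * ‖Function.extend e G 0 r‖) =
      Function.extend e (fun p => ‖F p‖ * ‖G p‖) 0 := by
    funext r
    by_cases hr : ∃ p, e p = r
    · obtain ⟨p, rfl⟩ := hr
      simp only [he.extend_apply]
    · simp [Function.extend_apply' _ _ _ hr]
  have hterm : ∀ h, (fun r => pairing' h (Function.extend e F 0 r) • Function.extend e G 0 r) =
      Function.extend e (fun p => pairing' h (F p) • G p) 0 := by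
    intro h
    funext r
    by_cases hr : ∃ p, e p = r
    · obtain ⟨p, rfl⟩ := hr
      simp only [he.extend_apply]
    · simp [Function.extend_apply' _ _ _ hr]
  have hs' : HasSum (fun r => ‖Function.extend e F 0 r‖ * ‖Function.extend e G 0 r‖)
      (∑' p, ‖F p‖ * ‖G p‖) := by
    rw [hnorm]
    exact (hasSum_extend_zero he).2 hs.hasSum
  refine ⟨_, Function.extend e F 0, Function.extend e G 0, ⟨hs'.summable, fun h => ?_⟩,
    hs'.tsum_eq, hO⟩
  rw [hterm]
  exact (hasSum_extend_zero he).2 (hO h)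

/-- Every `K ∈ ℋ^{1,1}` is the kernel of the operator `∑_{i,j} K_{i,j} ⟨·, ψ_{1,i}⟩ ψ_{2,j}`, where
`K_{i,j}` are the coefficients of `K`. -/
theorem exists_operator_of_kernel [Countable I] [Countable J] [CompleteSpace H₂]
    (h₁ : IsRegular ψ₁ (canonicalDual ψ₁) w₁) (h₂ : IsRegular ψ₂ (canonicalDual ψ₂) w₂) :
    ∃ C : ℝ, 0 ≤ C ∧ ∀ K : HOneTensor ψ₁ ψ₂ w₁ w₂,
      ∃ (O : HInf ψ₁ w₁⁻¹ →L[ℂ] HOne ψ₂ w₂) (f : ℕ → HOne ψ₁ w₁) (g : ℕ → HOne ψ₂ w₂),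
        Represents f g O ∧ ∑' r, ‖f r‖ * ‖g r‖ ≤ C * ‖K‖ ∧ IsKernel K O := by
  obtain ⟨C₁, hC₁, hb₁⟩ := h₁.exists_norm_atom_le
  obtain ⟨C₂, hC₂, hb₂⟩ := h₂.exists_norm_atom_le
  refine ⟨C₁ * C₂, mul_nonneg hC₁ hC₂, fun K => ?_⟩
  have hK := K.hasSum_norm_coef.mul_left (C₁ * C₂)
  have hle : ∀ p : I × J, ‖h₁.atom p.1‖ * ‖K.coef p • h₂.atom p.2‖ ≤
      C₁ * C₂ * ((tensorWeight w₁ w₂ p : ℝ) * ‖K.coef p‖) := by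
    intro p
    rw [norm_smul, tensorWeight_apply]
    calc _ ≤ (C₁ * w₁ p.1) * (‖K.coef p‖ * (C₂ * w₂ p.2)) :=
          mul_le_mul (hb₁ _) (mul_le_mul_of_nonneg_left (hb₂ _) (norm_nonneg _)) (by positivity)
            ((norm_nonneg _).trans (hb₁ _))
      _ = _ := by ring
  have hs : Summable fun p : I × J => ‖h₁.atom p.1‖ * ‖K.coef p • h₂.atom p.2‖ :=
    Summable.of_nonneg_of_le (fun p => by positivity) hle hK.summable
  obtain ⟨O, f, g, hR, hsum, hO⟩ := exists_represents h₁ (fun p : I × J => h₁.atom p.1)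
    (fun p => K.coef p • h₂.atom p.2) hs
  refine ⟨O, f, g, hR, ?_, fun f₁ f₂ => ?_⟩
  · rw [hsum]
    exact (hs.tsum_le_tsum hle hK.summable).trans_eq hK.tsum_eq
  · refine ((h₁.tensor h₂).hasSum_pairing K (infTensor f₁ f₂)).unique
      (((hO f₁).mapL (h₂.pairingL f₂)).congr_fun fun p => ?_)
    rw [frameCoef_infTensor h₁ h₂, map_smul, map_smul, h₂.pairingL_apply, h₂.pairing_atom,
      pairing', h₁.pairing_atom, map_mul, Complex.conj_conj, smul_eq_mul, smul_eq_mul]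
    ring

/-- The tensor product `f ⊗ g ∈ ℋ^{1,1}` of `f ∈ ℋ¹_{w₁}(ψ₁)` and `g ∈ ℋ¹_{w₂}(ψ₂)`, a kernel of
the operator `⟨·, f⟩ g`. -/
theorem exists_tensor [CompleteSpace H₂]
    (h₁ : IsRegular ψ₁ (canonicalDual ψ₁) w₁) (h₂ : IsRegular ψ₂ (canonicalDual ψ₂) w₂) :
    ∃ C : ℝ, 0 ≤ C ∧ ∀ (f : HOne ψ₁ w₁) (g : HOne ψ₂ w₂), ∃ K : HOneTensor ψ₁ ψ₂ w₁ w₂,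
      ‖K‖ ≤ C * (‖f‖ * ‖g‖) ∧ ∀ (f₁ : HInf ψ₁ w₁⁻¹) (f₂ : HInf ψ₂ w₂⁻¹),
        pairing K (infTensor f₁ f₂) = pairing' f₁ f * pairing g f₂ := by
  obtain ⟨C, hC0, hC⟩ := (h₁.tensor h₂).exists_synthesis
  refine ⟨C, hC0, fun f g => ?_⟩
  have hc : HasSum (fun p : I × J => (tensorWeight w₁ w₂ p : ℝ) *
      ‖conj (f.coef p.1) * g.coef p.2‖) (‖f‖ * ‖g‖) := by
    refine (hasSum_mul_prod f.hasSum_norm_coef g.hasSum_norm_coef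
      (fun i => mul_nonneg (w₁ i).2.le (norm_nonneg _))
      (fun j => mul_nonneg (w₂ j).2.le (norm_nonneg _))).congr_fun fun p => ?_
    rw [tensorWeight_apply, norm_mul, RCLike.norm_conj]
    ring
  obtain ⟨K, hK, hKp⟩ := hC _ _ hc
  refine ⟨K, hK, fun f₁ f₂ => ?_⟩
  have hp : HasSum (fun p : I × J =>
      conj (f.coef p.1 * conj (f₁.frameCoef ψ₁ p.1)) * (g.coef p.2 * conj (f₂.frameCoef ψ₂ p.2)))
      (pairing K (infTensor f₁ f₂)) := by
    refine (hKp (infTensor f₁ f₂)).congr_fun fun p => ?_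
    rw [frameCoef_infTensor h₁ h₂, map_mul, map_mul, Complex.conj_conj]
    ring
  have hf : HasSum (fun i => conj (f.coef i * conj (f₁.frameCoef ψ₁ i))) (pairing' f₁ f) :=
    Complex.hasSum_conj'.2 (h₁.hasSum_pairing f f₁)
  have hg := h₂.hasSum_pairing g f₂
  have hq := hf.mul hg hp.summable
  exact hp.unique hq

/-- Every operator `∑ᵣ ⟨·, f_r⟩ g_r` in `𝓑` has the kernel `∑ᵣ f_r ⊗ g_r`. -/
theorem exists_kernel_of_represents [CompleteSpace H₂]
    (h₁ : IsRegular ψ₁ (canonicalDual ψ₁) w₁) (h₂ : IsRegular ψ₂ (canonicalDual ψ₂) w₂) :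
    ∃ C : ℝ, 0 ≤ C ∧ ∀ (f : ℕ → HOne ψ₁ w₁) (g : ℕ → HOne ψ₂ w₂)
      (O : HInf ψ₁ w₁⁻¹ →L[ℂ] HOne ψ₂ w₂), Represents f g O →
        ∃ K : HOneTensor ψ₁ ψ₂ w₁ w₂, IsKernel K O ∧ ‖K‖ ≤ C * ∑' r, ‖f r‖ * ‖g r‖ := by
  obtain ⟨C, hC0, hC⟩ := exists_tensor h₁ h₂
  refine ⟨C, hC0, fun f g O hO => ?_⟩
  choose K hK hKp using fun r => hC (f r) (g r)
  have hs := hO.1.hasSum.mul_left C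
  have hsum : Summable K := Summable.of_norm_bounded hs.summable hK
  refine ⟨∑' r, K r, fun f₁ f₂ => ?_, tsum_of_norm_bounded hs hK⟩
  refine (hsum.hasSum.mapL ((h₁.tensor h₂).pairingL (infTensor f₁ f₂))).unique
    (((hO.2 f₁).mapL (h₂.pairingL f₂)).congr_fun fun r => ?_)
  rw [map_smul, h₂.pairingL_apply, (h₁.tensor h₂).pairingL_apply, hKp, smul_eq_mul]

end Kernel

end Coorbit

theorem mainTheorem2 {I J H₁ H₂ : Type*} [Countable I] [Countable J]
    [NormedAddCommGroup H₁] [InnerProductSpace ℂ H₁] [CompleteSpace H₁]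
    [NormedAddCommGroup H₂] [InnerProductSpace ℂ H₂] [CompleteSpace H₂]
    (𝒜₁ : Coorbit.SpectralMatrixAlgebra I) (𝒜₂ : Coorbit.SpectralMatrixAlgebra J)
    (ψ₁ : I → H₁) (ψ₂ : J → H₂)
    (hψ₁ : Coorbit.IsLocalisedFrame 𝒜₁ ψ₁) (hψ₂ : Coorbit.IsLocalisedFrame 𝒜₂ ψ₂)
    (w₁ : Coorbit.Weight I) (w₂ : Coorbit.Weight J)
    (hw₁ : Coorbit.Admissible 𝒜₁ w₁) (hw₂ : Coorbit.Admissible 𝒜₂ w₂) :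
    ∃ Φ : Coorbit.HOneTensor ψ₁ ψ₂ w₁ w₂ ≃ₗ[ℂ] Coorbit.kernelOperators ψ₁ ψ₂ w₁ w₂,
      (∃ c C : ℝ, 0 < c ∧ 0 < C ∧ ∀ K : Coorbit.HOneTensor ψ₁ ψ₂ w₁ w₂,
        c * ‖K‖ ≤ Coorbit.kernelOperatorNorm (Φ K).1 ∧
          Coorbit.kernelOperatorNorm (Φ K).1 ≤ C * ‖K‖) ∧
      (∀ (K : Coorbit.HOneTensor ψ₁ ψ₂ w₁ w₂)
          (f₁ : Coorbit.HInf ψ₁ w₁⁻¹) (f₂ : Coorbit.HInf ψ₂ w₂⁻¹),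
        Coorbit.pairing K (Coorbit.infTensor f₁ f₂) =
        Coorbit.pairing ((Φ K).1 f₁) f₂) ∧
      (∀ K : Coorbit.HOneTensor ψ₁ ψ₂ w₁ w₂, ∃! O : Coorbit.kernelOperators ψ₁ ψ₂ w₁ w₂,
        ∀ (f₁ : Coorbit.HInf ψ₁ w₁⁻¹) (f₂ : Coorbit.HInf ψ₂ w₂⁻¹),
        Coorbit.pairing K (Coorbit.infTensor f₁ f₂) = Coorbit.pairing (O.1 f₁) f₂) ∧
      (∀ O : Coorbit.kernelOperators ψ₁ ψ₂ w₁ w₂, ∃! K : Coorbit.HOneTensor ψ₁ ψ₂ w₁ w₂,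
        ∀ (f₁ : Coorbit.HInf ψ₁ w₁⁻¹) (f₂ : Coorbit.HInf ψ₂ w₂⁻¹),
        Coorbit.pairing K (Coorbit.infTensor f₁ f₂) = Coorbit.pairing (O.1 f₁) f₂) := by
  have h₁ := hψ₁.isRegular hw₁
  have h₂ := hψ₂.isRegular hw₂
  obtain ⟨C, hC0, hC⟩ := Coorbit.exists_operator_of_kernel h₁ h₂
  obtain ⟨D, hD0, hD⟩ := Coorbit.exists_kernel_of_represents h₁ h₂
  choose op f g hrep hsum hker using hC
  let Φ₀ : Coorbit.HOneTensor ψ₁ ψ₂ w₁ w₂ →ₗ[ℂ] Coorbit.kernelOperators ψ₁ ψ₂ w₁ w₂ :=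
    { toFun := fun K => ⟨op K, f K, g K, hrep K⟩
      map_add' := fun K K' => Subtype.ext <|
        Coorbit.IsKernel.operator_unique h₂ (hker (K + K')) ((hker K).add h₁ h₂ (hker K'))
      map_smul' := fun c K => Subtype.ext <|
        Coorbit.IsKernel.operator_unique h₂ (hker (c • K)) ((hker K).smul h₁ h₂ c) }
  have hexists : ∀ O : Coorbit.kernelOperators ψ₁ ψ₂ w₁ w₂, ∃ K, Coorbit.IsKernel K O.1 := by
    rintro ⟨O, f', g', hO⟩
    obtain ⟨K, hK, -⟩ := hD f' g' O hO
    exact ⟨K, hK⟩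
  have hbij : Function.Bijective Φ₀ := by
    refine ⟨fun K K' hKK' => ?_, fun O => ?_⟩
    · have hop : op K = op K' := congrArg Subtype.val hKK'
      exact (hker K).kernel_unique h₁ h₂ (hop ▸ hker K')
    · obtain ⟨K, hK⟩ := hexists O
      exact ⟨K, Subtype.ext ((hker K).operator_unique h₂ hK)⟩
  refine ⟨LinearEquiv.ofBijective Φ₀ hbij, ⟨(D + 1)⁻¹, C + 1, by positivity, by positivity,
    fun K => ⟨?_, ?_⟩⟩, hker, fun K => ⟨Φ₀ K, hker K, fun O hO => ?_⟩, fun O => ?_⟩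
  · refine le_csInf ⟨_, f K, g K, hrep K, rfl⟩ ?_
    rintro s ⟨f', g', hR, rfl⟩
    obtain ⟨K', hK', hn⟩ := hD f' g' _ hR
    rw [(hker K).kernel_unique h₁ h₂ hK', inv_mul_le_iff₀ (by positivity)]
    refine hn.trans (mul_le_mul_of_nonneg_right (by linarith) (tsum_nonneg fun r => by positivity))
  · refine (Coorbit.kernelOperatorNorm_le (hrep K)).trans ((hsum K).trans ?_)
    exact mul_le_mul_of_nonneg_right (by linarith) (norm_nonneg K)
  · exact Subtype.ext (Coorbit.IsKernel.operator_unique h₂ hO (hker K))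
  · obtain ⟨K, hK⟩ := hexists O
    exact ⟨K, hK, fun K' hK' => Coorbit.IsKernel.kernel_unique h₁ h₂ hK' hK⟩

end
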